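/- **Setting.** Let $N\ge 0$, $d_0,d_1,\dots,d_N\ge 0$, and let $v:\mathbb R^{d_0}\times\mathbb R^{d_1}\times\dots\times\mathbb R^{d_N}\to\mathbb R^{d_0}$ (Borel measurable) and $h_n:\mathbb R^{d_0}\times\mathbb R^{d_1}\times\dots\times\mathbb R^{d_n}\to\mathbb R^{d_n}$, $1\le n\le N$. Write $y_{1:n}=(y_1,\dots,y_n)$; $\|\cdot\|$ is the Euclidean norm. All constants $\mu_0,\mu_n,\ell_0,\ell_n,\ell_{A,n},\ell'_{A,n},\ell_{b,n},\ell'_{b,n},\omega_0,\omega_1,\omega_2,\sigma$ below are positive. Assume: 1. (Strong monotonicity of $h_n$) For all $n$, $x$, $y_{1:n-1}$, $\hat y_n$, $\bar y_n$: $\langle h_n(x,y_{1:n-1},\hat y_n)-h_n(x,y_{1:n-1},\bar y_n),\hat y_n-\bar y_n\rangle\ge\mu_n\|\hat y_n-\bar y_n\|^2$. 2. (Lipschitz continuity of $h_n$) For each $n$, either (a) $h_n$ is $\ell_n$-Lipschitz in each of the variables $x,y_1,\dots,y_n$; or (b) $h_n(x,y_{1:n})=A_n(x,y_{1:n-1})y_n+b_n(x,y_{1:n-1})$,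 where $A_n$ (in spectral norm) and $b_n$ are, respectively, $\ell_{A,n}$- and $\ell_{b,n}$-Lipschitz in each of the variables $x,y_1,\dots,y_{n-1}$ and bounded by $\ell'_{A,n}$ and $\ell'_{b,n}$. Under 1 and 2 the equation $h_n(x,y_{1:n-1},y)=0$ has a unique solution $y=y_n^*(x,y_{1:n-1})$. Put $y_n^\diamond(x)=y_n^*(x,y_1^\diamond(x),\dots,y_{n-1}^\diamond(x))$, recursively in $n$. No smoothness of these maps is assumed. 3. (Lipschitz condition on $v$) $\|v(\hat x,y^\diamond_{1:N}(\hat x))-v(\bar x,y_{1:N})\|\le\ell_0\bigl(\|\hat x-\bar x\|+\sum_{n=1}^N\|y_n-y_n^\diamond(\hat x)\|\bigr)$ for all $\hat x,\bar x,y_{1:N}$. 4. (Strong monotonicity of $v$) There is $x^*$ with $v(x^*,y^\diamond_{1:N}(x^*))=0$ and $\langle v(x,y^\diamond_{1:N}(x)),x-x^*\rangle\ge\mu_0\|x-x^*\|^2$ for all $x$ (so $x^*$ is the unique such zero). For a horizon $K$, consider random vectors with square-integrable initial point and, for $0\le k<K$, $$y_n^{k+1}=y_n^k-\beta_n^k\bigl(h_n(x^k,y_{1:n}^k)+\psi_n^k\bigr)\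 (1\le n\le N),\qquad x^{k+1}=x^k-\alpha^k\bigl(v(x^k,y_{1:N}^k)+\xi^k\bigr),$$ with deterministic step sizes $\alpha^k,\beta_n^k>0$ (which may depend on $K$). Let $\mathcal F^k$ be the $\sigma$-algebra generated by $x^l,y_1^l,\dots,y_N^l$, $l\le k$. 5. (Noise) $\xi^k,\psi_n^k$, $k<K$, are square integrable, $\mathbb E[\xi^k\mid\mathcal F^k]=0$, $\mathbb E[\psi_n^k\mid\mathcal F^k]=0$, and $$\operatorname{Var}[\psi_n^k\mid\mathcal F^k]\le\omega_0\|h_n(x^k,y^k_{1:n})\|^2+\sigma^2,\qquad \operatorname{Var}[\xi^k\mid\mathcal F^k]\le\omega_1\|v(x^k,y^k_{1:N})\|^2+\sigma^2+\omega_2\sum_{n=1}^N\|h_n(x^k,y_{1:n}^k)\|^2 .$$ **Theorem.** There is $\kappa\in(0,1]$, depending only on $N$ and the constants other than $\sigma$, such that for all $a>0$, $B$, $D$ and $\sigma$ there are $C$ and $K_0$, depending only on $N$, the constants, $a$, $B$ and $D$, with the following property. Let $K\ge K_0$, suppose that 1--5 hold, that $$\mathbb E\|x^0-x^*\|^2+\sum_{n=1}^N\mathbb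 E\|y_n^0-y_n^*(x^0,y^0_{1:n-1})\|^2\le D,$$ and that the step sizes are chosen of order $\Theta(\log K/K)$, with main step size large enough and suitable ratios, namely for all $k<K$ $$\frac{4}{\mu_0}\frac{\log(aK)}{K}\le\alpha^k\le B\frac{\log K}{K},\qquad \beta_n^k\le B\frac{\log K}{K},\qquad \alpha^k\le\kappa\,\beta_n^k\ (1\le n\le N),\qquad \beta_i^k\le\kappa\,\beta_j^k\ (1\le i<j\le N).$$ Then the following expectations are finite and $$\mathbb E\|x^K-x^*\|^2+\sum_{n=1}^N\mathbb E\|y_n^K-y_n^*(x^K,y_{1:n-1}^K)\|^2\le C\,\frac{\log K}{K},$$ $$\mathbb E\|x^K-x^*\|^2+\sum_{n=1}^N\mathbb E\|y_n^K-y_n^\diamond(x^*)\|^2\le C\,\frac{\log K}{K};$$ that is, both quantities are $\tilde{\mathcal O}(1/K)$. -/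

import Mathlib

open MeasureTheory

namespace MSSA

/-- `ℝ^m` with its Euclidean norm. -/
abbrev Vec (m : ℕ) : Type := EuclideanSpace ℝ (Fin m)

/-- The space of tuples `y_{1:N} = (y_1, …, y_N)`, `y_n ∈ ℝ^{d_n}`.  The secondary sequences
are indexed by `Fin N`, in increasing order. -/
abbrev Tuple {N : ℕ} (d : Fin N → ℕ) : Type := (n : Fin N) → Vec (d n)

/-- The space of tuples `y_{1:n-1}`: the components strictly before `n`. -/
abbrev Prev {N : ℕ} (d : Fin N → ℕ) (n : Fin N) : Type := (i : Set.Iio n) → Vec (d i)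

/-- The part `y_{1:n-1}` of a tuple `y_{1:N}`. -/
def prev {N : ℕ} {d : Fin N → ℕ} (n : Fin N) (y : Tuple d) : Prev d n := fun i => y i

/-- The secondary operators, `h_n (x, y_{1:n-1}, y_n) ∈ ℝ^{d_n}`. -/
abbrev SecondaryOps {N : ℕ} (d₀ : ℕ) (d : Fin N → ℕ) : Type :=
  (n : Fin N) → Vec d₀ → Prev d n → Vec (d n) → Vec (d n)

/-- The positive constants of the problem: strong monotonicity moduli `μ₀, μ_n`, Lipschitz
constants `ℓ₀, ℓ_n`, the Lipschitz constants and bounds of the affine case, and the constants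
`ω₀, ω₁, ω₂` in the noise variance bounds. -/
structure Constants (N : ℕ) where
  μ₀ : ℝ
  μ : Fin N → ℝ
  ℓ₀ : ℝ
  ℓ : Fin N → ℝ
  ℓA : Fin N → ℝ
  ℓA' : Fin N → ℝ
  ℓb : Fin N → ℝ
  ℓb' : Fin N → ℝ
  ω₀ : ℝ
  ω₁ : ℝ
  ω₂ : ℝ
  μ₀_pos : 0 < μ₀
  μ_pos : ∀ n, 0 < μ n
  ℓ₀_pos : 0 < ℓ₀
  ℓ_pos : ∀ n, 0 < ℓ n
  ℓA_pos : ∀ n, 0 < ℓA n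
  ℓA'_pos : ∀ n, 0 < ℓA' n
  ℓb_pos : ∀ n, 0 < ℓb n
  ℓb'_pos : ∀ n, 0 < ℓb' n
  ω₀_pos : 0 < ω₀
  ω₁_pos : 0 < ω₁
  ω₂_pos : 0 < ω₂

section Operators

variable {N d₀ : ℕ} {d : Fin N → ℕ}

/-- `h_n (x, y_{1:n-1}, ·)` is `μ_n`-strongly monotone, for every `n`, `x`, `y_{1:n-1}`. -/
def SecondaryStronglyMonotone (c : Constants N) (h : SecondaryOps d₀ d) : Prop :=
  ∀ (n : Fin N) (x : Vec d₀) (p : Prev d n) (y y' : Vec (d n)),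
    c.μ n * ‖y - y'‖ ^ 2 ≤ inner ℝ (h n x p y - h n x p y') (y - y')

/-- A map of `(x, y_{1:n-1})` is `L`-Lipschitz with respect to each of the variables
`x, y_1, …, y_{n-1}`, the others being fixed. -/
def LipschitzEach {n : Fin N} {W : Type*} [NormedAddCommGroup W]
    (L : ℝ) (F : Vec d₀ → Prev d n → W) : Prop :=
  (∀ x x' p, ‖F x p - F x' p‖ ≤ L * ‖x - x'‖) ∧
  (∀ x (p p' : Prev d n) (i : Set.Iio n), (∀ j, j ≠ i → p j = p' j) →
    ‖F x p - F x p'‖ ≤ L * ‖p i - p' i‖)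

/-- Condition (a): `h_n` is `ℓ_n`-Lipschitz with respect to each of `x, y_1, …, y_n`. -/
def CondLipschitz (c : Constants N) (h : SecondaryOps d₀ d) (n : Fin N) : Prop :=
  (∀ y, LipschitzEach (c.ℓ n) (fun x p => h n x p y)) ∧
  (∀ x p y y', ‖h n x p y - h n x p y'‖ ≤ c.ℓ n * ‖y - y'‖)

/-- Condition (b): `h_n (x, y_{1:n}) = A_n (x, y_{1:n-1}) y_n + b_n (x, y_{1:n-1})` with `A_n`
and `b_n` Lipschitz with respect to each variable and bounded.  The norm on continuous linear
maps is the operator norm, i.e. the spectral norm of the matrix. -/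
def CondAffine (c : Constants N) (h : SecondaryOps d₀ d) (n : Fin N) : Prop :=
  ∃ (A : Vec d₀ → Prev d n → (Vec (d n) →L[ℝ] Vec (d n))) (b : Vec d₀ → Prev d n → Vec (d n)),
    (∀ x p y, h n x p y = A x p y + b x p) ∧
    LipschitzEach (c.ℓA n) A ∧ (∀ x p, ‖A x p‖ ≤ c.ℓA' n) ∧
    LipschitzEach (c.ℓb n) b ∧ (∀ x p, ‖b x p‖ ≤ c.ℓb' n)

/-- Each `h_n` satisfies condition (a) or condition (b). -/
def SecondaryLipschitz (c : Constants N) (h : SecondaryOps d₀ d) : Prop :=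
  ∀ n, CondLipschitz c h n ∨ CondAffine c h n

/-- The fixed point `y_n^* (x, y_{1:n-1})`: the solution `y` of `h_n (x, y_{1:n-1}, y) = 0`.
For operators satisfying `SecondaryStronglyMonotone` and `SecondaryLipschitz` the solution exists
and is unique, so that the choice made here is the only possible one. -/
noncomputable def yStar (h : SecondaryOps d₀ d) (n : Fin N) (x : Vec d₀) (p : Prev d n) :
    Vec (d n) :=
  Classical.epsilon (fun y => h n x p y = 0)

/-- `y_n^◇ (x) = y_n^* (x, y_1^◇ (x), …, y_{n-1}^◇ (x))`. -/
noncomputable def yDiamond (h : SecondaryOps d₀ d) (x : Vec d₀) (n : Fin N) : Vec (d n) :=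
  yStar h n x (fun i => yDiamond h x i.1)
termination_by n
decreasing_by exact i.2

theorem yDiamond_eq (h : SecondaryOps d₀ d) (x : Vec d₀) (n : Fin N) :
    yDiamond h x n = yStar h n x (prev n (yDiamond h x)) := by
  rw [yDiamond]
  rfl

/-- The Lipschitz condition on the main operator `v`. -/
def MainLipschitz (c : Constants N) (v : Vec d₀ → Tuple d → Vec d₀) (h : SecondaryOps d₀ d) :
    Prop :=
  ∀ (x x' : Vec d₀) (y : Tuple d),
    ‖v x (yDiamond h x) - v x' y‖ ≤ c.ℓ₀ * (‖x - x'‖ + ∑ n, ‖y n - yDiamond h x n‖)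

/-- Strong monotonicity of the main operator with respect to its zero `x^*`
(the inequality makes `x^*` the unique zero of `x ↦ v (x, y^◇_{1:N} (x))`). -/
def MainStronglyMonotone (c : Constants N) (v : Vec d₀ → Tuple d → Vec d₀)
    (h : SecondaryOps d₀ d) (xs : Vec d₀) : Prop :=
  v xs (yDiamond h xs) = 0 ∧
  ∀ x, c.μ₀ * ‖x - xs‖ ^ 2 ≤ inner ℝ (v x (yDiamond h x)) (x - xs)

end Operators

section Recursion

variable {N d₀ : ℕ} {d : Fin N → ℕ} {Ω : Type*}

/-- `ℱ^k`, the `σ`-algebra generated by `x^l, y_1^l, …, y_N^l`, `l ≤ k`. -/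
abbrev history (x : ℕ → Ω → Vec d₀) (y : ℕ → Ω → Tuple d) (k : ℕ) : MeasurableSpace Ω :=
  ⨆ l : Fin (k + 1), MeasurableSpace.comap (x l) inferInstance ⊔
    MeasurableSpace.comap (y l) inferInstance

/-- The conditional variance `Var[X | m] = E[‖X - E[X | m]‖² | m]` of a random vector. -/
noncomputable def condVariance {r : ℕ} (m : MeasurableSpace Ω) {_mΩ : MeasurableSpace Ω}
    (P : Measure Ω) (X : Ω → Vec r) : Ω → ℝ :=
  P[fun w => ‖X w - (P[X | m]) w‖ ^ 2 | m]

/-- `(x^k, y_{1:N}^k)`, `0 ≤ k ≤ K`, are random vectors generated by the MSSA recursion with step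
sizes `α^k, β_n^k` and noise `ξ^k, ψ_n^k`; the starting point is square integrable. -/
structure IsMSSA [MeasurableSpace Ω] (P : Measure Ω) (v : Vec d₀ → Tuple d → Vec d₀)
    (h : SecondaryOps d₀ d) (K : ℕ) (α : ℕ → ℝ) (β : ℕ → Fin N → ℝ)
    (x : ℕ → Ω → Vec d₀) (y : ℕ → Ω → Tuple d)
    (ξ : ℕ → Ω → Vec d₀) (ψ : ℕ → Ω → Tuple d) : Prop where
  measurable_x : ∀ k ≤ K, Measurable (x k)
  measurable_y : ∀ k ≤ K, Measurable (y k)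
  memLp_x : MemLp (x 0) 2 P
  memLp_y : ∀ n, MemLp (fun w => y 0 w n) 2 P
  step_y : ∀ k < K, ∀ w n,
    y (k + 1) w n = y k w n - β k n • (h n (x k w) (prev n (y k w)) (y k w n) + ψ k w n)
  step_x : ∀ k < K, ∀ w, x (k + 1) w = x k w - α k • (v (x k w) (y k w) + ξ k w)

/-- The noises `ξ^k` and `ψ_n^k`, `k < K`, are square-integrable martingale differences with
respect to `ℱ^k`, with state-dependent bounds on their conditional variances. -/
structure NoiseAssumption [MeasurableSpace Ω] (c : Constants N) (σ : ℝ) (P : Measure Ω)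
    (v : Vec d₀ → Tuple d → Vec d₀) (h : SecondaryOps d₀ d) (K : ℕ)
    (x : ℕ → Ω → Vec d₀) (y : ℕ → Ω → Tuple d)
    (ξ : ℕ → Ω → Vec d₀) (ψ : ℕ → Ω → Tuple d) : Prop where
  memLp_ξ : ∀ k < K, MemLp (ξ k) 2 P
  memLp_ψ : ∀ k < K, ∀ n, MemLp (fun w => ψ k w n) 2 P
  condExp_ξ : ∀ k < K, P[ξ k | history x y k] =ᵐ[P] 0
  condExp_ψ : ∀ k < K, ∀ n, P[fun w => ψ k w n | history x y k] =ᵐ[P] 0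
  condVar_ψ : ∀ k < K, ∀ n, ∀ᵐ w ∂P,
    condVariance (history x y k) P (fun w => ψ k w n) w ≤
      c.ω₀ * ‖h n (x k w) (prev n (y k w)) (y k w n)‖ ^ 2 + σ ^ 2
  condVar_ξ : ∀ k < K, ∀ᵐ w ∂P,
    condVariance (history x y k) P (ξ k) w ≤
      c.ω₁ * ‖v (x k w) (y k w)‖ ^ 2 + σ ^ 2 +
        c.ω₂ * ∑ n, ‖h n (x k w) (prev n (y k w)) (y k w n)‖ ^ 2

end Recursion

/-- Step sizes of order `log K / K` for a run of length `K`: the upper bounds are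
`B log K / K`, the main step size is at least `(4 / μ₀) log (a K) / K`, and the step sizes are
ordered up to the factor `κ`: `α^k ≤ κ β_n^k`, and `β_i^k ≤ κ β_j^k` for `i < j`
(hence every step size is also bounded below by a multiple of `log K / K`). -/
structure StepSizes {N : ℕ} (c : Constants N) (κ a B : ℝ) (K : ℕ)
    (α : ℕ → ℝ) (β : ℕ → Fin N → ℝ) : Prop where
  α_pos : ∀ k < K, 0 < α k
  β_pos : ∀ k < K, ∀ n, 0 < β k n
  α_lower : ∀ k < K, 4 / c.μ₀ * (Real.log (a * K) / K) ≤ α k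
  α_upper : ∀ k < K, α k ≤ B * (Real.log K / K)
  β_upper : ∀ k < K, ∀ n, β k n ≤ B * (Real.log K / K)
  α_le_β : ∀ k < K, ∀ n, α k ≤ κ * β k n
  β_le_β : ∀ k < K, ∀ i j, i < j → β k i ≤ κ * β k j

end MSSA

namespace MSSA

/-! ### Fixed-point maps: existence, Lipschitz bounds, continuity. -/

section Operators

variable {N d₀ : ℕ} {d : Fin N → ℕ}

/-! The natural Lyapunov function is the squared error of `x` plus the squared residuals `y_n -
y_n^*(x, y_{1:n-1})`. The difficulty is that each step moves the target `y_n^*` as well, and this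
displacement contains the fresh noise of `x` and of `y_i`, `i < n`. If `y_n^*` is only Lipschitz,
that part of the displacement need not have conditional mean zero to leading order, and its cross
term with the residual spoils the rate.

The remedy is to remove the noise before looking at the residuals. Each noise is passed through the
linear filter `w^{k+1} = (1 - μ₀ γ^k) w^k - γ^k ζ^k`, `w^0 = 0`, where `γ` is the step size of the
sequence concerned, and the filtered noise is subtracted from the iterate. The resulting sequences
`z`, `q` satisfy `z^{k+1} = z^k - α (v(x, y) - μ₀ (x - z))` and the analogue for `q_n`
(`cleanMain_succ`, `cleanSecondary_succ`). No fresh noise enters: the increments are step sizes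
times quantities controlled by the current errors and by the gap between `(x, y)` and `(z, q)`,
which is the filtered noise. The displacement of `y_n^*` is then small pathwise and a weighted Young
inequality handles it. The weight costs `1/β_n`, which the ratios `α ≤ κ β_n`, `β_i ≤ κ β_n`
compensate, leaving a small factor `κ` (`residual_step`). Summing over `n` gives a pathwise
contraction at rate `α μ₀ / 2`, perturbed by step sizes times the squared gap (`lyapunov_step`).

The filtered noises are linear in martingale differences, so their second moments contract at rate
`α μ₀` up to a source of order (step size)² (`expNoise_succ_le`). With `V` the expected Lyapunov
function of `(z, q)` and `Q` the expected squared filtered noise, a suitable combination `V + Γ Q`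
contracts at rate `θ = log(aK)/K` with source `O((log K / K)²)` (`combined_recursion`). After `K`
steps the initial error has shrunk by `(1 - θ)^K ≤ 1/(aK)`, and the accumulated source is `O(log K /
K)` (`final_bound`). Adding the filtered noise back gives both estimates. -/

theorem LipschitzEach.joint {n : Fin N} {W : Type*} [NormedAddCommGroup W] {L : ℝ}
    {F : Vec d₀ → Prev d n → W} (hF : LipschitzEach L F) (x x' : Vec d₀) (p p' : Prev d n) :
    ‖F x p - F x' p'‖ ≤ L * (‖x - x'‖ + ∑ i, ‖p i - p' i‖) := by
  classical
  -- The coordinates are exchanged one at a time, `s` being the set already exchanged, so the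
  -- separate constants telescope without loss.
  have key : ∀ s : Finset (Set.Iio n),
      ‖F x' p - F x' (s.piecewise p' p)‖ ≤ L * ∑ i ∈ s, ‖p i - p' i‖ := by
    intro s
    induction s using Finset.induction_on with
    | empty => simp
    | insert a s ha ih =>
      have h1 := hF.2 x' (s.piecewise p' p) ((insert a s).piecewise p' p) a (by
        intro j hj
        simp [Finset.piecewise, hj])
      have e1 : s.piecewise p' p a = p a := by simp [ha]
      have e2 : (insert a s).piecewise p' p a = p' a := by simp
      rw [e1, e2] at h1
      rw [Finset.sum_insert ha, mul_add]
      calc _ ≤ ‖F x' p - F x' (s.piecewise p' p)‖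
            + ‖F x' (s.piecewise p' p) - F x' ((insert a s).piecewise p' p)‖ :=
            norm_sub_le_norm_sub_add_norm_sub _ _ _
        _ ≤ _ := by linarith
  have h2 := key Finset.univ
  rw [Finset.piecewise_univ] at h2
  calc _ ≤ ‖F x p - F x' p‖ + ‖F x' p - F x' p'‖ := norm_sub_le_norm_sub_add_norm_sub _ _ _
    _ ≤ _ := by linarith [hF.1 x x' p]

theorem sum_Iio_eq_sum_range (n : Fin N) (f : ℕ → ℝ) :
    ∑ i : Set.Iio n, f (i.1 : ℕ) = ∑ i ∈ Finset.range n, f i := by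
  refine Finset.sum_bij (fun i _ => (i.1 : ℕ)) ?_ ?_ ?_ ?_
  · intro i _
    exact Finset.mem_range.2 (Fin.lt_def.1 i.2)
  · intro i _ j _ hij
    exact Subtype.ext (Fin.ext hij)
  · intro b hb
    have hb' : b < n := by simpa using hb
    exact ⟨⟨⟨b, hb'.trans n.2⟩, by simpa [Fin.lt_def] using hb'⟩, Finset.mem_univ _, rfl⟩
  · intro i _
    rfl

theorem sum_Iio_le_sum (n : Fin N) {f : Fin N → ℝ} (hf : ∀ i, 0 ≤ f i) :
    ∑ i : Set.Iio n, f i.1 ≤ ∑ i, f i := by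
  classical
  rw [← Finset.sum_image (f := f) (s := Finset.univ) (g := fun i : Set.Iio n => i.1)
    (fun a _ b _ h => Subtype.ext h)]
  exact Finset.sum_le_sum_of_subset_of_nonneg (Finset.subset_univ _) (fun i _ _ => hf i)

/-- A discrete Grönwall inequality. -/
theorem le_of_le_add_sum_Iio {A M : ℝ} (hM : 0 ≤ M) (hA : 0 ≤ A) {e : Fin N → ℝ}
    (h : ∀ n, e n ≤ A + M * ∑ i : Set.Iio n, e i.1) (n : Fin N) : e n ≤ (1 + M) ^ N * A := by
  have key : ∀ n : Fin N, e n ≤ (1 + M) ^ (n : ℕ) * A := by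
    intro n
    induction n using WellFoundedLT.induction with
    | ind n ih =>
      have h1 : ∑ i : Set.Iio n, e i.1 ≤ ∑ i : Set.Iio n, (1 + M) ^ (i.1 : ℕ) * A :=
        Finset.sum_le_sum fun i _ => ih i.1 i.2
      rw [sum_Iio_eq_sum_range n (fun i => (1 + M) ^ i * A), ← Finset.sum_mul] at h1
      have h2 := geom_sum_mul (1 + M) (n : ℕ)
      calc e n ≤ A + M * ((∑ i ∈ Finset.range n, (1 + M) ^ i) * A) := by
            linarith [h n, mul_le_mul_of_nonneg_left h1 hM]
        _ = A + ((∑ i ∈ Finset.range n, (1 + M) ^ i) * (1 + M - 1)) * A := by ring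
        _ = _ := by rw [h2]; ring
  refine (key n).trans (mul_le_mul_of_nonneg_right ?_ hA)
  exact pow_le_pow_right₀ (by linarith) n.2.le

/-- A strongly monotone Lipschitz map of a Hilbert space has a zero. -/
theorem exists_zero_of_strongly_monotone {E : Type*} [NormedAddCommGroup E]
    [InnerProductSpace ℝ E] [CompleteSpace E] {f : E → E} {m L : ℝ} (hm : 0 < m) (hL : 0 < L)
    (hmono : ∀ y y', m * ‖y - y'‖ ^ 2 ≤ inner ℝ (f y - f y') (y - y'))
    (hlip : ∀ y y', ‖f y - f y'‖ ≤ L * ‖y - y'‖) : ∃ y, f y = 0 := by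
  -- The gradient step contracts squared distances by `1 - 2ηm + η²L²`, which is at most `1 - ηm`
  -- because `ηL² ≤ m`. The term `m²` in the denominator gives `ηm ≤ 1` without knowing `m ≤ L`.
  set η := m / (L ^ 2 + m ^ 2) with hη
  have hηpos : 0 < η := by positivity
  set q := 1 - η * m with hq
  have hq1 : η * m ≤ 1 := by
    rw [hη, div_mul_eq_mul_div, div_le_one (by positivity)]
    nlinarith [sq_nonneg L]
  have hq0 : 0 ≤ q := by linarith
  have hql : q < 1 := by nlinarith
  have hηL : η * L ^ 2 ≤ m := by
    rw [hη, div_mul_eq_mul_div, div_le_iff₀ (by positivity)]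
    nlinarith [sq_nonneg m, pow_pos hm 3]
  have hc : ∀ y y', ‖(y - η • f y) - (y' - η • f y')‖ ^ 2 ≤ q * ‖y - y'‖ ^ 2 := by
    intro y y'
    have e : (y - η • f y) - (y' - η • f y') = (y - y') - η • (f y - f y') := by
      rw [smul_sub]; abel
    rw [e, norm_sub_sq_real, inner_smul_right, norm_smul, Real.norm_of_nonneg hηpos.le,
      real_inner_comm]
    have h1 := hmono y y'
    have h2 : ‖f y - f y'‖ ^ 2 ≤ L ^ 2 * ‖y - y'‖ ^ 2 := by
      rw [← mul_pow]; exact pow_le_pow_left₀ (norm_nonneg _) (hlip y y') 2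
    have h3 : (η * ‖f y - f y'‖) ^ 2 ≤ η * m * ‖y - y'‖ ^ 2 := by
      calc _ = η * η * ‖f y - f y'‖ ^ 2 := by ring
        _ ≤ η * η * (L ^ 2 * ‖y - y'‖ ^ 2) := by gcongr
        _ = η * (η * L ^ 2) * ‖y - y'‖ ^ 2 := by ring
        _ ≤ _ := by gcongr
    have h4 := mul_le_mul_of_nonneg_left h1 hηpos.le
    rw [hq]
    linarith
  have hK : ContractingWith (Real.sqrt q).toNNReal (fun y => y - η • f y) := by
    refine ⟨?_, LipschitzWith.of_dist_le_mul fun y y' => ?_⟩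
    · rw [Real.toNNReal_lt_one]
      exact (Real.sqrt_lt' one_pos).2 (by simpa using hql)
    · rw [dist_eq_norm, dist_eq_norm, Real.coe_toNNReal _ (Real.sqrt_nonneg q)]
      refine abs_le_of_sq_le_sq' ?_ (by positivity) |>.2
      rw [mul_pow, Real.sq_sqrt hq0]
      exact hc y y'
  have hfix := hK.fixedPoint_isFixedPt
  refine ⟨ContractingWith.fixedPoint _ hK, ?_⟩
  have h5 : ∀ y, y - η • f y = y → f y = 0 := by
    intro y hy
    have : η • f y = 0 := by simpa using hy
    exact (smul_eq_zero.1 this).resolve_left hηpos.ne'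
  exact h5 _ hfix

theorem SecondaryLipschitz.norm_sub_last_le {c : Constants N} {h : SecondaryOps d₀ d}
    (hh : SecondaryLipschitz c h) (n : Fin N) (x : Vec d₀) (p : Prev d n) (y y' : Vec (d n)) :
    ‖h n x p y - h n x p y'‖ ≤ (c.ℓ n + c.ℓA' n) * ‖y - y'‖ := by
  rcases hh n with ha | ⟨A, b, hAb, -, hA', -, -⟩
  · nlinarith [ha.2 x p y y', norm_nonneg (y - y'), c.ℓA'_pos n]
  · rw [hAb, hAb, add_sub_add_right_eq_sub, ← map_sub]
    refine ((A x p).le_opNorm _).trans (mul_le_mul_of_nonneg_right ?_ (norm_nonneg _))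
    linarith [hA' x p, c.ℓ_pos n]

/-- In the affine case the variation of `A_n` is multiplied by `y_n`, hence the factor `‖y‖`: there
is no Lipschitz constant in `(x, y_{1:n-1})` uniform in `y_n`. -/
theorem SecondaryLipschitz.norm_sub_le {c : Constants N} {h : SecondaryOps d₀ d}
    (hh : SecondaryLipschitz c h) (n : Fin N) (x x' : Vec d₀) (p p' : Prev d n) (y : Vec (d n)) :
    ‖h n x p y - h n x' p' y‖ ≤
      (c.ℓ n + c.ℓA n * ‖y‖ + c.ℓb n) * (‖x - x'‖ + ∑ i, ‖p i - p' i‖) := by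
  have hΔ : 0 ≤ ‖x - x'‖ + ∑ i, ‖p i - p' i‖ := by positivity
  have hA0 := c.ℓA_pos n
  have hb0 := c.ℓb_pos n
  rcases hh n with ha | ⟨A, b, hAb, hA, -, hb, -⟩
  · refine ((ha.1 y).joint x x' p p').trans (mul_le_mul_of_nonneg_right ?_ hΔ)
    nlinarith [norm_nonneg y]
  · have e : h n x p y - h n x' p' y = (A x p - A x' p') y + (b x p - b x' p') := by
      rw [hAb, hAb, sub_apply]; abel
    have h1 := hA.joint x x' p p'
    have h2 := hb.joint x x' p p'
    rw [e]
    calc _ ≤ ‖A x p - A x' p'‖ * ‖y‖ + ‖b x p - b x' p'‖ :=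
          (norm_add_le _ _).trans (add_le_add_left ((A x p - A x' p').le_opNorm y) _)
      _ ≤ _ := by nlinarith [mul_le_mul_of_nonneg_right h1 (norm_nonneg y), c.ℓ_pos n]

theorem yStar_spec {c : Constants N} {h : SecondaryOps d₀ d}
    (hm : SecondaryStronglyMonotone c h) (hh : SecondaryLipschitz c h)
    (n : Fin N) (x : Vec d₀) (p : Prev d n) : h n x p (yStar h n x p) = 0 :=
  Classical.epsilon_spec (p := fun y => h n x p y = 0)
    (exists_zero_of_strongly_monotone (c.μ_pos n) (add_pos (c.ℓ_pos n) (c.ℓA'_pos n))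
      (hm n x p) (hh.norm_sub_last_le n x p))

theorem norm_le_div_of_mul_sq_le {E : Type*} [NormedAddCommGroup E] [InnerProductSpace ℝ E]
    {m : ℝ} (hm : 0 < m) {a b : E} (h : m * ‖b‖ ^ 2 ≤ inner ℝ a b) : ‖b‖ ≤ ‖a‖ / m := by
  rw [le_div_iff₀ hm]
  rcases (norm_nonneg b).eq_or_lt with h0 | h0
  · rw [← h0]; simp
  · have := h.trans (real_inner_le_norm a b)
    nlinarith

/-- The Lipschitz constant of the fixed-point maps. -/
noncomputable def Constants.fixLip (c : Constants N) (n : Fin N) : ℝ :=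
  (c.ℓ n + c.ℓA n * (c.ℓb' n / c.μ n) + c.ℓb n) / c.μ n

theorem Constants.fixLip_pos (c : Constants N) (n : Fin N) : 0 < c.fixLip n := by
  have := c.ℓ_pos n
  have := c.ℓA_pos n
  have := c.ℓb_pos n
  have := c.ℓb'_pos n
  have := c.μ_pos n
  unfold Constants.fixLip
  positivity

/-- Strong monotonicity at `(x, p)` bounds the distance of the two zeros by the change of `h_n`
evaluated at one of them. In the affine case that zero lies in a fixed ball, so the factor `‖y‖` of
`norm_sub_le` is harmless. -/
theorem norm_yStar_sub_le {c : Constants N} {h : SecondaryOps d₀ d}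
    (hm : SecondaryStronglyMonotone c h) (hh : SecondaryLipschitz c h)
    (n : Fin N) (x x' : Vec d₀) (p p' : Prev d n) :
    ‖yStar h n x p - yStar h n x' p'‖ ≤
      c.fixLip n * (‖x - x'‖ + ∑ i, ‖p i - p' i‖) := by
  have hμ := c.μ_pos n
  have hΔ : 0 ≤ ‖x - x'‖ + ∑ i, ‖p i - p' i‖ := by positivity
  set y := yStar h n x p with hy
  set y' := yStar h n x' p' with hy'
  have hz : h n x p y = 0 := yStar_spec hm hh n x p
  have hz' : h n x' p' y' = 0 := yStar_spec hm hh n x' p'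
  have h1 : ‖y - y'‖ ≤ ‖h n x p y'  - h n x' p' y'‖ / c.μ n := by
    have := norm_le_div_of_mul_sq_le hμ (hm n x p y y')
    rwa [hz, zero_sub, norm_neg, ← sub_zero (h n x p y'), ← hz'] at this
  have hcoef : ‖h n x p y' - h n x' p' y'‖ ≤
      (c.ℓ n + c.ℓA n * (c.ℓb' n / c.μ n) + c.ℓb n) * (‖x - x'‖ + ∑ i, ‖p i - p' i‖) := by
    have hA0 := c.ℓA_pos n
    have hb0 := c.ℓb_pos n
    have hb'0 := c.ℓb'_pos n
    have hq : 0 < c.ℓb' n / c.μ n := by positivity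
    rcases hh n with ha | ⟨A, b, hAb, hA, hA', hb, hb'⟩
    · refine ((ha.1 y').joint x x' p p').trans (mul_le_mul_of_nonneg_right ?_ hΔ)
      nlinarith
    · refine (hh.norm_sub_le n x x' p p' y').trans (mul_le_mul_of_nonneg_right ?_ hΔ)
      -- Comparing the zero with the point `0`, where `h_n` equals `b_n`, bounds its norm by `ℓb' /
      -- μ`.
      have h2 := norm_le_div_of_mul_sq_le hμ (hm n x' p' y' 0)
      rw [sub_zero, hz', zero_sub, norm_neg, hAb, map_zero, zero_add] at h2
      have h3 : ‖y'‖ ≤ c.ℓb' n / c.μ n := h2.trans (by gcongr; exact hb' x' p')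
      gcongr
  refine h1.trans ?_
  rw [Constants.fixLip, div_mul_eq_mul_div]
  gcongr

theorem continuous_of_norm_sub_le {n : Fin N} {W : Type*} [NormedAddCommGroup W] {L : ℝ}
    {F : Vec d₀ → Prev d n → W}
    (hF : ∀ x x' p p', ‖F x p - F x' p'‖ ≤ L * (‖x - x'‖ + ∑ i, ‖p i - p' i‖)) :
    Continuous fun z : Vec d₀ × Prev d n => F z.1 z.2 := by
  rw [continuous_iff_continuousAt]
  intro z₀
  refine tendsto_iff_norm_sub_tendsto_zero.2 ?_
  refine squeeze_zero (fun _ => norm_nonneg _) (fun z => hF z.1 z₀.1 z.2 z₀.2) ?_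
  have : Continuous fun z : Vec d₀ × Prev d n =>
      L * (‖z.1 - z₀.1‖ + ∑ i, ‖z.2 i - z₀.2 i‖) := by fun_prop
  simpa using this.tendsto z₀

/-- The Lipschitz constant in `y_n` is uniform in the other variables, which turns separate
continuity into joint continuity. This is needed for measurability. -/
theorem continuous_secondary {c : Constants N} {h : SecondaryOps d₀ d}
    (hh : SecondaryLipschitz c h) (n : Fin N) :
    Continuous fun z : (Vec d₀ × Prev d n) × Vec (d n) => h n z.1.1 z.1.2 z.2 := by
  have h0 : 0 ≤ c.ℓ n + c.ℓA' n := (add_pos (c.ℓ_pos n) (c.ℓA'_pos n)).le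
  refine continuous_prod_of_continuous_lipschitzWith'
    (fun z : (Vec d₀ × Prev d n) × Vec (d n) => h n z.1.1 z.1.2 z.2) ⟨_, h0⟩ ?_ ?_
  · intro a
    refine LipschitzWith.of_dist_le_mul fun y y' => ?_
    rw [dist_eq_norm, dist_eq_norm]
    exact hh.norm_sub_last_le n a.1 a.2 y y'
  · intro y
    exact continuous_of_norm_sub_le fun x x' p p' => hh.norm_sub_le n x x' p p' y

theorem continuous_prev (n : Fin N) : Continuous (prev n : Tuple d → Prev d n) :=
  continuous_pi fun i => continuous_apply i.1

end Operators

/-! ### Deterministic bounds on the noise-free increments. -/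

section Pathwise

variable {N d₀ : ℕ} {d : Fin N → ℕ}

/-- The regularity of the operators used in the analysis, with constants uniform in `n`. -/
structure RegularOps (μ₀ m ℓ₀ L M : ℝ) (v : Vec d₀ → Tuple d → Vec d₀) (h : SecondaryOps d₀ d)
    (xs : Vec d₀) : Prop where
  μ₀_pos : 0 < μ₀
  m_pos : 0 < m
  ℓ₀_pos : 0 < ℓ₀
  L_pos : 0 < L
  M_pos : 0 < M
  zero : ∀ n x p, h n x p (yStar h n x p) = 0
  mono : ∀ n x p y y', m * ‖y - y'‖ ^ 2 ≤ inner ℝ (h n x p y - h n x p y') (y - y')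
  lip : ∀ n x p y y', ‖h n x p y - h n x p y'‖ ≤ L * ‖y - y'‖
  star : ∀ n x x' p p',
    ‖yStar h n x p - yStar h n x' p'‖ ≤ M * (‖x - x'‖ + ∑ i, ‖p i - p' i‖)
  main_lip : ∀ x x' y,
    ‖v x (yDiamond h x) - v x' y‖ ≤ ℓ₀ * (‖x - x'‖ + ∑ n, ‖y n - yDiamond h x n‖)
  main_zero : v xs (yDiamond h xs) = 0
  main_mono : ∀ x, μ₀ * ‖x - xs‖ ^ 2 ≤ inner ℝ (v x (yDiamond h x)) (x - xs)

/-- The residual `q_n - y_n^* (z, q_{1:n-1})`. -/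
noncomputable def residual (h : SecondaryOps d₀ d) (z : Vec d₀) (q : Tuple d) (n : Fin N) :
    Vec (d n) :=
  q n - yStar h n z (prev n q)

/-- The distance between `(x, y)` and `(z, q)`. -/
noncomputable def gap (x : Vec d₀) (y : Tuple d) (z : Vec d₀) (q : Tuple d) : ℝ :=
  ‖x - z‖ + ∑ n, ‖y n - q n‖

/-- The Lyapunov function `‖z - x^*‖² + ∑ ‖q_n - y_n^* (z, q_{1:n-1})‖²`. -/
noncomputable def lyapunov (h : SecondaryOps d₀ d) (xs z : Vec d₀) (q : Tuple d) : ℝ :=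
  ‖z - xs‖ ^ 2 + ∑ n, ‖residual h z q n‖ ^ 2

/-- A growth constant for the noise-free increments. -/
noncomputable def growth (N : ℕ) (μ₀ ℓ₀ L M : ℝ) : ℝ :=
  μ₀ + L * (1 + M) + ℓ₀ * (1 + N * (1 + M) ^ N) * (1 + M)

theorem gap_nonneg (x : Vec d₀) (y : Tuple d) (z : Vec d₀) (q : Tuple d) : 0 ≤ gap x y z q := by
  unfold gap; positivity

theorem norm_fst_le_gap (x : Vec d₀) (y : Tuple d) (z : Vec d₀) (q : Tuple d) :
    ‖x - z‖ ≤ gap x y z q :=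
  le_add_of_nonneg_right (by positivity)

theorem norm_snd_le_gap (x : Vec d₀) (y : Tuple d) (z : Vec d₀) (q : Tuple d) (n : Fin N) :
    ‖y n - q n‖ ≤ gap x y z q := by
  have := Finset.single_le_sum (f := fun n => ‖y n - q n‖) (fun _ _ => norm_nonneg _)
    (Finset.mem_univ n)
  unfold gap
  linarith [norm_nonneg (x - z)]

theorem norm_prev_le_gap (x : Vec d₀) (y : Tuple d) (z : Vec d₀) (q : Tuple d) (n : Fin N) :
    ‖x - z‖ + ∑ i, ‖prev n y i - prev n q i‖ ≤ gap x y z q :=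
  add_le_add_right (sum_Iio_le_sum n (f := fun i => ‖y i - q i‖) fun _ => norm_nonneg _) _

theorem norm_residual_le_sum (h : SecondaryOps d₀ d) (z : Vec d₀) (q : Tuple d) (n : Fin N) :
    ‖residual h z q n‖ ≤ ∑ i, ‖residual h z q i‖ :=
  Finset.single_le_sum (f := fun n => ‖residual h z q n‖) (fun _ _ => norm_nonneg _)
    (Finset.mem_univ n)

/-- One step in a strongly monotone direction with a perturbation of size `t`. -/
theorem norm_sub_smul_sq_le {E : Type*} [NormedAddCommGroup E] [InnerProductSpace ℝ E]
    {r g : E} {m G t β : ℝ} (hm : 0 < m) (hβ : 0 ≤ β) (hβG : 4 * G ^ 2 * β ≤ m)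
    (h1 : m * ‖r‖ ^ 2 - G * t * ‖r‖ ≤ inner ℝ g r) (h2 : ‖g‖ ≤ G * (‖r‖ + t)) :
    ‖r - β • g‖ ^ 2 ≤ (1 - β * m) * ‖r‖ ^ 2 + β * (2 * G ^ 2 / m + m / 2) * t ^ 2 := by
  have h3 : ‖g‖ ^ 2 ≤ G ^ 2 * (‖r‖ + t) ^ 2 := by
    rw [← mul_pow]; exact pow_le_pow_left₀ (norm_nonneg _) h2 2
  have h4 : 2 * (G * t * ‖r‖) ≤ m / 2 * ‖r‖ ^ 2 + 2 * G ^ 2 / m * t ^ 2 := by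
    have : 0 ≤ (m * ‖r‖ - 2 * (G * t)) ^ 2 / (2 * m) := by positivity
    have e : (m * ‖r‖ - 2 * (G * t)) ^ 2 / (2 * m) =
        m / 2 * ‖r‖ ^ 2 + 2 * G ^ 2 / m * t ^ 2 - 2 * (G * t * ‖r‖) := by
      field_simp; ring
    linarith
  have h5 : β * G ^ 2 * (‖r‖ + t) ^ 2 ≤ m / 2 * (‖r‖ ^ 2 + t ^ 2) := by
    have : (‖r‖ + t) ^ 2 ≤ 2 * (‖r‖ ^ 2 + t ^ 2) := by nlinarith [sq_nonneg (‖r‖ - t)]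
    calc _ ≤ β * G ^ 2 * (2 * (‖r‖ ^ 2 + t ^ 2)) := by gcongr
      _ = (4 * G ^ 2 * β) * ((‖r‖ ^ 2 + t ^ 2) / 2) := by ring
      _ ≤ m * ((‖r‖ ^ 2 + t ^ 2) / 2) := by gcongr
      _ = _ := by ring
  rw [norm_sub_sq_real, inner_smul_right, norm_smul, Real.norm_of_nonneg hβ, real_inner_comm]
  have h6 : (β * ‖g‖) ^ 2 ≤ β * (m / 2 * (‖r‖ ^ 2 + t ^ 2)) := by
    calc _ = β * (β * ‖g‖ ^ 2) := by ring
      _ ≤ β * (β * (G ^ 2 * (‖r‖ + t) ^ 2)) := by gcongr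
      _ = β * (β * G ^ 2 * (‖r‖ + t) ^ 2) := by ring
      _ ≤ _ := by gcongr
  have h7 := mul_le_mul_of_nonneg_left h1 hβ
  have h8 := mul_le_mul_of_nonneg_left h4 hβ
  linarith

namespace RegularOps

variable {μ₀ m ℓ₀ L M : ℝ} {v : Vec d₀ → Tuple d → Vec d₀} {h : SecondaryOps d₀ d} {xs : Vec d₀}

/-- Residuals are measured against fixed points with the actual `q_{1:n-1}`; replacing these by the
exact ones propagates errors through the levels, and the discrete Grönwall inequality sums them. -/
theorem norm_sub_yDiamond_le (ops : RegularOps μ₀ m ℓ₀ L M v h xs) (z : Vec d₀) (q : Tuple d)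
    (n : Fin N) :
    ‖q n - yDiamond h z n‖ ≤ (1 + M) ^ N * ∑ i, ‖residual h z q i‖ := by
  refine le_of_le_add_sum_Iio (e := fun n => ‖q n - yDiamond h z n‖) ops.M_pos.le
    (by positivity) (fun n => ?_) n
  have h1 := ops.star n z z (prev n q) (prev n (yDiamond h z))
  rw [sub_self, norm_zero, zero_add, ← yDiamond_eq] at h1
  calc ‖q n - yDiamond h z n‖ ≤ ‖residual h z q n‖ + ‖yStar h n z (prev n q) - yDiamond h z n‖ :=
        norm_sub_le_norm_sub_add_norm_sub _ _ _
    _ ≤ _ := add_le_add (norm_residual_le_sum h z q n) h1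

theorem norm_yDiamond_sub_le (ops : RegularOps μ₀ m ℓ₀ L M v h xs) (z z' : Vec d₀) (n : Fin N) :
    ‖yDiamond h z n - yDiamond h z' n‖ ≤ (1 + M) ^ N * (M * ‖z - z'‖) := by
  have hM := ops.M_pos
  refine le_of_le_add_sum_Iio (e := fun n => ‖yDiamond h z n - yDiamond h z' n‖) ops.M_pos.le
    (by positivity) (fun n => ?_) n
  have h1 := ops.star n z z' (prev n (yDiamond h z)) (prev n (yDiamond h z'))
  rw [← yDiamond_eq, ← yDiamond_eq, mul_add] at h1
  exact h1

theorem growth_pos (ops : RegularOps μ₀ m ℓ₀ L M v h xs) : 0 < growth N μ₀ ℓ₀ L M := by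
  have := ops.μ₀_pos
  have := ops.ℓ₀_pos
  have := ops.L_pos
  have := ops.M_pos
  unfold growth
  positivity

/-- The Lipschitz condition on `v` is anchored at points `(z, y^◇(z))`, so `v x y` is compared with
such a point at the noise-free `z`; the distance from `y` to `y^◇(z)` is split at `q`. -/
theorem norm_main_sub_le (ops : RegularOps μ₀ m ℓ₀ L M v h xs) (x z : Vec d₀) (y q : Tuple d) :
    ‖v z (yDiamond h z) - v x y‖ ≤
      ℓ₀ * (1 + N * (1 + M) ^ N) * (gap x y z q + ∑ i, ‖residual h z q i‖) := by
  have hM := ops.M_pos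
  set ρ := ∑ i, ‖residual h z q i‖ with hρ
  have hρ0 : 0 ≤ ρ := by positivity
  have hs0 := gap_nonneg x y z q
  have h1 : ∑ n, ‖y n - yDiamond h z n‖ ≤ ∑ n, ‖y n - q n‖ + N * ((1 + M) ^ N * ρ) := by
    calc _ ≤ ∑ n, (‖y n - q n‖ + (1 + M) ^ N * ρ) := Finset.sum_le_sum fun n _ =>
          (norm_sub_le_norm_sub_add_norm_sub _ (q n) _).trans
            (add_le_add_right (ops.norm_sub_yDiamond_le z q n) _)
      _ = _ := by simp [Finset.sum_add_distrib]
  have h2 : ‖z - x‖ + ∑ n, ‖y n - yDiamond h z n‖ ≤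
      gap x y z q + N * ((1 + M) ^ N * ρ) := by
    rw [gap, norm_sub_rev x z]; linarith
  have hN : 0 ≤ (N : ℝ) * (1 + M) ^ N := by positivity
  calc _ ≤ ℓ₀ * (gap x y z q + N * ((1 + M) ^ N * ρ)) :=
        (ops.main_lip z x y).trans (mul_le_mul_of_nonneg_left h2 ops.ℓ₀_pos.le)
    _ ≤ ℓ₀ * ((1 + N * (1 + M) ^ N) * (gap x y z q + ρ)) := by
        refine mul_le_mul_of_nonneg_left ?_ ops.ℓ₀_pos.le
        nlinarith [mul_nonneg hN hs0]
    _ = _ := by ring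

theorem norm_main_diamond_le (ops : RegularOps μ₀ m ℓ₀ L M v h xs) (z : Vec d₀) :
    ‖v z (yDiamond h z)‖ ≤ ℓ₀ * (1 + N * (1 + M) ^ N * M) * ‖z - xs‖ := by
  have h1 := ops.main_lip z xs (yDiamond h xs)
  rw [ops.main_zero, sub_zero] at h1
  refine h1.trans ?_
  rw [mul_assoc]
  refine mul_le_mul_of_nonneg_left ?_ ops.ℓ₀_pos.le
  calc _ ≤ ‖z - xs‖ + ∑ _n : Fin N, (1 + M) ^ N * (M * ‖z - xs‖) := by
        gcongr with n
        rw [norm_sub_rev z xs]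
        exact ops.norm_yDiamond_sub_le xs z n
    _ = _ := by simp; ring

theorem norm_mainDrift_le (ops : RegularOps μ₀ m ℓ₀ L M v h xs) (x z : Vec d₀) (y q : Tuple d) :
    ‖v x y - μ₀ • (x - z)‖ ≤
      growth N μ₀ ℓ₀ L M * (‖z - xs‖ + (gap x y z q + ∑ i, ‖residual h z q i‖)) := by
  have hM := ops.M_pos
  have hl := ops.ℓ₀_pos
  have hL := ops.L_pos
  have hμ := ops.μ₀_pos
  have h1 := ops.norm_main_sub_le x z y q
  have h2 := ops.norm_main_diamond_le z
  have h3 := norm_fst_le_gap x y z q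
  set s := gap x y z q
  set ρ := ∑ i, ‖residual h z q i‖ with hρ
  have hρ0 : 0 ≤ ρ := by positivity
  have hs0 : 0 ≤ s := gap_nonneg x y z q
  set u := ‖z - xs‖
  have hu0 : 0 ≤ u := norm_nonneg _
  have e : v x y - μ₀ • (x - z) =
      v z (yDiamond h z) - (v z (yDiamond h z) - v x y) - μ₀ • (x - z) := by abel
  have h4 : ‖v x y - μ₀ • (x - z)‖ ≤ ‖v z (yDiamond h z)‖ + ‖v z (yDiamond h z) - v x y‖
      + μ₀ * ‖x - z‖ := by
    rw [e]
    refine (norm_sub_le _ _).trans (add_le_add (norm_sub_le _ _) ?_)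
    rw [norm_smul, Real.norm_of_nonneg hμ.le]
  set P := (N : ℝ) * (1 + M) ^ N with hP
  have hP0 : 0 ≤ P := by positivity
  have h5 : ℓ₀ * (1 + P * M) * u ≤ ℓ₀ * (1 + P) * (1 + M) * u := by
    have : 1 + P * M ≤ (1 + P) * (1 + M) := by nlinarith
    calc _ ≤ ℓ₀ * ((1 + P) * (1 + M)) * u := by gcongr
      _ = _ := by ring
  have h6 : ℓ₀ * (1 + P) * (s + ρ) ≤ ℓ₀ * (1 + P) * (1 + M) * (s + ρ) := by
    have : 1 ≤ 1 + M := by linarith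
    have := mul_le_mul_of_nonneg_left this (show 0 ≤ ℓ₀ * (1 + P) * (s + ρ) by positivity)
    linarith
  have h7 : μ₀ * ‖x - z‖ ≤ μ₀ * (u + (s + ρ)) := by gcongr; linarith
  have h8 : 0 ≤ L * (1 + M) * (u + (s + ρ)) := by positivity
  unfold growth
  linarith

/-- Monotonicity is used at `(z, y^◇(z))`; both the error in `v` and the correction `μ₀ (x - z)` are
perturbations bounded by the gap and the residuals. -/
theorem le_inner_mainDrift (ops : RegularOps μ₀ m ℓ₀ L M v h xs) (x z : Vec d₀)
    (y q : Tuple d) :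
    μ₀ * ‖z - xs‖ ^ 2 -
        growth N μ₀ ℓ₀ L M * (gap x y z q + ∑ i, ‖residual h z q i‖) * ‖z - xs‖ ≤
      inner ℝ (v x y - μ₀ • (x - z)) (z - xs) := by
  have hM := ops.M_pos
  have hl := ops.ℓ₀_pos
  have hL := ops.L_pos
  have hμ := ops.μ₀_pos
  have h1 := ops.norm_main_sub_le x z y q
  have h3 := norm_fst_le_gap x y z q
  set s := gap x y z q
  set ρ := ∑ i, ‖residual h z q i‖ with hρ
  have hρ0 : 0 ≤ ρ := by positivity
  have hs0 : 0 ≤ s := gap_nonneg x y z q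
  set P := (N : ℝ) * (1 + M) ^ N with hP
  have hP0 : 0 ≤ P := by positivity
  have e : v x y - μ₀ • (x - z) =
      v z (yDiamond h z) - ((v z (yDiamond h z) - v x y) + μ₀ • (x - z)) := by abel
  have h2 : ‖(v z (yDiamond h z) - v x y) + μ₀ • (x - z)‖ ≤ growth N μ₀ ℓ₀ L M * (s + ρ) := by
    have h6 : ℓ₀ * (1 + P) * (s + ρ) ≤ ℓ₀ * (1 + P) * (1 + M) * (s + ρ) := by
      have : 1 ≤ 1 + M := by linarith
      have := mul_le_mul_of_nonneg_left this (show 0 ≤ ℓ₀ * (1 + P) * (s + ρ) by positivity)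
      linarith
    have h7 : μ₀ * ‖x - z‖ ≤ μ₀ * (s + ρ) := by gcongr; linarith
    have h8 : 0 ≤ L * (1 + M) * (s + ρ) := by positivity
    refine (norm_add_le _ _).trans ?_
    rw [norm_smul, Real.norm_of_nonneg hμ.le]
    unfold growth
    linarith
  rw [e, inner_sub_left]
  have h4 := (real_inner_le_norm ((v z (yDiamond h z) - v x y) + μ₀ • (x - z)) (z - xs)).trans
    (mul_le_mul_of_nonneg_right h2 (norm_nonneg _))
  linarith [ops.main_mono z]

theorem norm_sub_yStar_add_residual_le (ops : RegularOps μ₀ m ℓ₀ L M v h xs) (x z : Vec d₀)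
    (y q : Tuple d) (n : Fin N) :
    ‖y n - (yStar h n x (prev n y) + residual h z q n)‖ ≤ (1 + M) * gap x y z q := by
  have h1 := ops.star n z x (prev n q) (prev n y)
  have h2 := norm_prev_le_gap x y z q n
  have h3 : ‖z - x‖ + ∑ i, ‖prev n q i - prev n y i‖ ≤ gap x y z q := by
    simpa only [norm_sub_rev z x, norm_sub_rev (prev n q _)] using h2
  have e : y n - (yStar h n x (prev n y) + residual h z q n) =
      (y n - q n) + (yStar h n z (prev n q) - yStar h n x (prev n y)) := by
    unfold residual; abel
  rw [e]
  refine (norm_add_le _ _).trans ?_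
  have := mul_le_mul_of_nonneg_left h3 ops.M_pos.le
  linarith [norm_snd_le_gap x y z q n]

theorem norm_sub_yStar_le (ops : RegularOps μ₀ m ℓ₀ L M v h xs) (x z : Vec d₀)
    (y q : Tuple d) (n : Fin N) :
    ‖y n - yStar h n x (prev n y)‖ ≤ ‖residual h z q n‖ + (1 + M) * gap x y z q := by
  have h1 := ops.norm_sub_yStar_add_residual_le x z y q n
  have e : y n - yStar h n x (prev n y) = residual h z q n +
    (y n - (yStar h n x (prev n y) + residual h z q n)) := by abel
  rw [e]
  exact (norm_add_le _ _).trans (add_le_add_right h1 _)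

theorem norm_secondary_le (ops : RegularOps μ₀ m ℓ₀ L M v h xs) (x : Vec d₀)
    (y : Tuple d) (n : Fin N) :
    ‖h n x (prev n y) (y n)‖ ≤ L * ‖y n - yStar h n x (prev n y)‖ := by
  simpa [ops.zero] using ops.lip n x (prev n y) (y n) (yStar h n x (prev n y))

theorem norm_secondaryDrift_le (ops : RegularOps μ₀ m ℓ₀ L M v h xs) (x z : Vec d₀)
    (y q : Tuple d) (n : Fin N) :
    ‖h n x (prev n y) (y n) - μ₀ • (y n - q n)‖ ≤
      growth N μ₀ ℓ₀ L M * (‖residual h z q n‖ + gap x y z q) := by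
  have hM := ops.M_pos
  have hl := ops.ℓ₀_pos
  have hL := ops.L_pos
  have hμ := ops.μ₀_pos
  have h1 := ops.norm_secondary_le x y n
  have h2 := ops.norm_sub_yStar_le x z y q n
  have h3 := norm_snd_le_gap x y z q n
  set s := gap x y z q
  have hs0 : 0 ≤ s := gap_nonneg x y z q
  set r := ‖residual h z q n‖
  have hr0 : 0 ≤ r := norm_nonneg _
  have h4 : 0 ≤ ℓ₀ * (1 + N * (1 + M) ^ N) * (1 + M) * (r + s) := by positivity
  have h5 := mul_le_mul_of_nonneg_left h2 hL.le
  have h6 := mul_le_mul_of_nonneg_left h3 hμ.le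
  have h7 : 0 ≤ L * M * r := by positivity
  have h8 : 0 ≤ μ₀ * r := by positivity
  refine (norm_sub_le _ _).trans ?_
  rw [norm_smul, Real.norm_of_nonneg hμ.le]
  unfold growth
  linarith

/-- The clean residual `r` is transplanted to the fixed point of the noisy arguments: monotonicity
is applied between `y^* + r` and `y^*` with `(x, y_{1:n-1})` held fixed. Thus `h_n` varies only in
its last variable, where it is uniformly Lipschitz, and all other variation goes through the
Lipschitz map `y_n^*`. -/
theorem le_inner_secondaryDrift (ops : RegularOps μ₀ m ℓ₀ L M v h xs) (x z : Vec d₀)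
    (y q : Tuple d) (n : Fin N) :
    m * ‖residual h z q n‖ ^ 2 - growth N μ₀ ℓ₀ L M * gap x y z q * ‖residual h z q n‖ ≤
      inner ℝ (h n x (prev n y) (y n) - μ₀ • (y n - q n)) (residual h z q n) := by
  have hM := ops.M_pos
  have hl := ops.ℓ₀_pos
  have hL := ops.L_pos
  have hμ := ops.μ₀_pos
  have h3 := norm_snd_le_gap x y z q n
  have h2 := ops.norm_sub_yStar_add_residual_le x z y q n
  set s := gap x y z q
  have hs0 : 0 ≤ s := gap_nonneg x y z q
  set r := residual h z q n
  set ys := yStar h n x (prev n y)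
  have h1 := ops.mono n x (prev n y) (ys + r) ys
  rw [add_sub_cancel_left, ops.zero, sub_zero] at h1
  have h4 := ops.lip n x (prev n y) (ys + r) (y n)
  rw [norm_sub_rev (ys + r)] at h4
  have e : h n x (prev n y) (y n) - μ₀ • (y n - q n) = h n x (prev n y) (ys + r) -
      ((h n x (prev n y) (ys + r) - h n x (prev n y) (y n)) + μ₀ • (y n - q n)) := by abel
  have h5 : ‖(h n x (prev n y) (ys + r) - h n x (prev n y) (y n)) + μ₀ • (y n - q n)‖ ≤
      growth N μ₀ ℓ₀ L M * s := by
    have h6 : 0 ≤ ℓ₀ * (1 + N * (1 + M) ^ N) * (1 + M) * s := by positivity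
    have h7 := mul_le_mul_of_nonneg_left h2 hL.le
    have h8 := mul_le_mul_of_nonneg_left h3 hμ.le
    refine (norm_add_le _ _).trans ?_
    rw [norm_smul, Real.norm_of_nonneg hμ.le]
    unfold growth
    linarith
  rw [e, inner_sub_left]
  have h9 := (real_inner_le_norm ((h n x (prev n y) (ys + r) - h n x (prev n y) (y n)) +
    μ₀ • (y n - q n)) r).trans (mul_le_mul_of_nonneg_right h5 (norm_nonneg _))
  linarith

end RegularOps

end Pathwise

/-! ### Pathwise contraction of the Lyapunov function. -/

section Step

/-- The factor of the squared perturbation in `norm_sub_smul_sq_le`. -/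
noncomputable def pertConst (m G : ℝ) : ℝ := 2 * G ^ 2 / m + m / 2

/-- The factor of the squared drift of the fixed points in the residual recursion. -/
noncomputable def shiftConst (N : ℕ) (m G M : ℝ) : ℝ := 6 * M ^ 2 * G ^ 2 * (N + 1) / m

/-- The perturbation factor in the Lyapunov recursion. -/
noncomputable def lyapunovConst (N : ℕ) (μ₀ m G M : ℝ) : ℝ :=
  2 * pertConst m G + 2 * pertConst μ₀ G + 3 * N * shiftConst N m G M

/-- The step size ratio is small enough for the Lyapunov recursion. -/
structure RatioSmall (N : ℕ) (μ₀ m G M κ : ℝ) : Prop where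
  pos : 0 < κ
  le_one : κ ≤ 1
  main : κ * (3 * N * shiftConst N m G M) ≤ μ₀ / 2
  secondary : κ * (N * shiftConst N m G M * (3 * N + 2) + 2 * pertConst μ₀ G * N) ≤ m / 4
  rate : κ * μ₀ ≤ m / 2

theorem exists_ratioSmall (N : ℕ) {μ₀ m : ℝ} (G M : ℝ) (hμ : 0 < μ₀) (hm : 0 < m) :
    ∃ κ, RatioSmall N μ₀ m G M κ := by
  have hs : 0 ≤ shiftConst N m G M := by unfold shiftConst; positivity
  have hp : 0 ≤ pertConst μ₀ G := by unfold pertConst; positivity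
  set S := 3 * N * shiftConst N m G M
  set T := N * shiftConst N m G M * (3 * N + 2) + 2 * pertConst μ₀ G * N
  have hS : 0 ≤ S := by positivity
  have hT : 0 ≤ T := by positivity
  have key : ∀ A b D : ℝ, 0 ≤ A → 0 < b → 0 ≤ D → A / b ≤ D → 1 / (1 + D) * A ≤ b := by
    intro A b D hA hb hD h
    rw [div_mul_eq_mul_div, one_mul, div_le_iff₀ (by linarith)]
    rw [div_le_iff₀ hb] at h
    linarith
  have h1 : 0 ≤ S / (μ₀ / 2) := by positivity
  have h2 : 0 ≤ T / (m / 4) := by positivity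
  have h3 : 0 ≤ μ₀ / (m / 2) := by positivity
  -- The denominator dominates the ratio required by each of the three smallness conditions.
  refine ⟨1 / (1 + (S / (μ₀ / 2) + T / (m / 4) + μ₀ / (m / 2))), by positivity, ?_, ?_, ?_, ?_⟩
  · rw [div_le_one (by positivity)]; linarith
  · exact key _ _ _ hS (by positivity) (by positivity) (by linarith)
  · exact key _ _ _ hT (by positivity) (by positivity) (by linarith)
  · exact key _ _ _ hμ.le (by positivity) (by positivity) (by linarith)

/-- The step sizes are small enough for the Lyapunov recursion. -/
structure StepSmall {N : ℕ} (μ₀ m G κ α : ℝ) (β : Fin N → ℝ) : Prop where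
  α_pos : 0 < α
  β_pos : ∀ n, 0 < β n
  α_small : 4 * G ^ 2 * α ≤ μ₀
  β_small : ∀ n, 4 * G ^ 2 * β n ≤ m
  β_le : ∀ n, β n * m ≤ 1
  α_le_β : ∀ n, α ≤ κ * β n
  β_le_β : ∀ i j, i < j → β i ≤ κ * β j

theorem norm_add_sq_le_weighted {E : Type*} [NormedAddCommGroup E] [InnerProductSpace ℝ E]
    (a b : E) {ε : ℝ} (hε : 0 < ε) :
    ‖a + b‖ ^ 2 ≤ (1 + ε) * ‖a‖ ^ 2 + (1 + 1 / ε) * ‖b‖ ^ 2 := by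
  have h1 := real_inner_le_norm a b
  have h2 : 2 * (‖a‖ * ‖b‖) ≤ ε * ‖a‖ ^ 2 + 1 / ε * ‖b‖ ^ 2 := by
    have h3 : 0 ≤ (ε * ‖a‖ - ‖b‖) ^ 2 / ε := by positivity
    have e : (ε * ‖a‖ - ‖b‖) ^ 2 / ε =
        ε * ‖a‖ ^ 2 + 1 / ε * ‖b‖ ^ 2 - 2 * (‖a‖ * ‖b‖) := by field_simp; ring
    linarith
  rw [norm_add_sq_real]
  linarith

theorem add_sum_sq_le {N : ℕ} (n : Fin N) (a : ℝ) (b : Fin N → ℝ) :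
    (a + ∑ i : Set.Iio n, b i.1) ^ 2 ≤
      2 * (N + 1) * (a ^ 2 + ∑ i : Set.Iio n, b i.1 ^ 2) := by
  have h1 : (∑ i : Set.Iio n, b i.1) ^ 2 ≤ N * ∑ i : Set.Iio n, b i.1 ^ 2 := by
    refine (sq_sum_le_card_mul_sum_sq (s := Finset.univ)).trans ?_
    refine mul_le_mul_of_nonneg_right ?_ (by positivity)
    have : Fintype.card (Set.Iio n) ≤ Fintype.card (Fin N) :=
      Fintype.card_le_of_injective _ Subtype.val_injective
    simp only [Fintype.card_fin] at this
    exact_mod_cast this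
  have h2 : 0 ≤ ∑ i : Set.Iio n, b i.1 ^ 2 := by positivity
  nlinarith [sq_nonneg (a - ∑ i : Set.Iio n, b i.1), mul_nonneg (Nat.cast_nonneg (α := ℝ) N)
    (sq_nonneg a)]

variable {N d₀ : ℕ} {d : Fin N → ℕ} {μ₀ m ℓ₀ L M : ℝ} {v : Vec d₀ → Tuple d → Vec d₀}
  {h : SecondaryOps d₀ d} {xs : Vec d₀}

/-- The noise-free increment of `z`. -/
noncomputable def mainDrift (μ₀ : ℝ) (v : Vec d₀ → Tuple d → Vec d₀) (x : Vec d₀) (y : Tuple d)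
    (z : Vec d₀) : Vec d₀ :=
  v x y - μ₀ • (x - z)

/-- The noise-free increment of `q_n`. -/
noncomputable def secondaryDrift (μ₀ : ℝ) (h : SecondaryOps d₀ d) (x : Vec d₀) (y : Tuple d)
    (q : Tuple d) (n : Fin N) : Vec (d n) :=
  h n x (prev n y) (y n) - μ₀ • (y n - q n)

namespace RegularOps

/-- The new residual is a monotone step `a` plus the displacement `δ` of the fixed point. Young's
inequality with weight `β_n m / 2` gives up half of the contraction of `a` and multiplies `‖δ‖²` by
at most `3 / (β_n m)`. As `‖δ‖²` is quadratic in `α` and the `β_i`, `i < n`, one factor from each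
square is at most `κ β_n`: it cancels `1/β_n` and leaves `κ`. -/
theorem residual_step (ops : RegularOps μ₀ m ℓ₀ L M v h xs) {κ α : ℝ} {β : Fin N → ℝ}
    (hst : StepSmall μ₀ m (growth N μ₀ ℓ₀ L M) κ α β) (x z z' : Vec d₀) (y q q' : Tuple d)
    (hz : z' = z - α • mainDrift μ₀ v x y z)
    (hq : ∀ n, q' n = q n - β n • secondaryDrift μ₀ h x y q n) (hκ : 0 < κ) (n : Fin N) :
    ‖residual h z' q' n‖ ^ 2 ≤ (1 - β n * m / 2) * ‖residual h z q n‖ ^ 2 +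
      2 * β n * pertConst m (growth N μ₀ ℓ₀ L M) * gap x y z q ^ 2 +
      κ * shiftConst N m (growth N μ₀ ℓ₀ L M) M *
        (α * (‖z - xs‖ + (gap x y z q + ∑ i, ‖residual h z q i‖)) ^ 2 +
          ∑ i, β i * (‖residual h z q i‖ + gap x y z q) ^ 2) := by
  have hM := ops.M_pos
  have hm := ops.m_pos
  set G := growth N μ₀ ℓ₀ L M
  have hG : 0 < G := ops.growth_pos
  set s := gap x y z q
  have hs0 : 0 ≤ s := gap_nonneg x y z q
  set ρ := ∑ i, ‖residual h z q i‖ with hρ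
  have hρ0 : 0 ≤ ρ := by positivity
  have hα := hst.α_pos
  have hβ := hst.β_pos
  set A := α * (G * (‖z - xs‖ + (s + ρ))) with hA
  set B : Fin N → ℝ := fun i => β i * (G * (‖residual h z q i‖ + s)) with hB
  have hA0 : 0 ≤ A := by positivity
  have hB0 : ∀ i, 0 ≤ B i := fun i => by have := hβ i; positivity
  set a := residual h z q n - β n • secondaryDrift μ₀ h x y q n
  set δ := yStar h n z (prev n q) - yStar h n z' (prev n q')
  have e : residual h z' q' n = a + δ := by
    simp only [a, δ, residual, hq n]; abel
  have hδ : ‖δ‖ ≤ M * (A + ∑ i : Set.Iio n, B i.1) := by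
    refine (ops.star n z z' (prev n q) (prev n q')).trans ?_
    refine mul_le_mul_of_nonneg_left (add_le_add ?_ (Finset.sum_le_sum fun i _ => ?_)) hM.le
    · rw [hz, sub_sub_cancel, norm_smul, Real.norm_of_nonneg hα.le]
      exact mul_le_mul_of_nonneg_left (ops.norm_mainDrift_le x z y q) hα.le
    · change ‖q i.1 - q' i.1‖ ≤ _
      rw [hq, sub_sub_cancel, norm_smul, Real.norm_of_nonneg (hβ i.1).le]
      exact mul_le_mul_of_nonneg_left (ops.norm_secondaryDrift_le x z y q i.1) (hβ i.1).le
  have hδ2 : ‖δ‖ ^ 2 ≤ M ^ 2 * (2 * (N + 1) * (A ^ 2 + ∑ i : Set.Iio n, B i.1 ^ 2)) := by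
    refine (pow_le_pow_left₀ (norm_nonneg _) hδ 2).trans ?_
    rw [mul_pow]
    exact mul_le_mul_of_nonneg_left (add_sum_sq_le n A B) (sq_nonneg M)
  have hA2 : A ^ 2 ≤ β n * (κ * G ^ 2 * (α * (‖z - xs‖ + (s + ρ)) ^ 2)) := by
    calc A ^ 2 = α * (G ^ 2 * (α * (‖z - xs‖ + (s + ρ)) ^ 2)) := by rw [hA]; ring
      _ ≤ κ * β n * (G ^ 2 * (α * (‖z - xs‖ + (s + ρ)) ^ 2)) :=
          mul_le_mul_of_nonneg_right (hst.α_le_β n) (by positivity)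
      _ = _ := by ring
  have hB2 : ∑ i : Set.Iio n, B i.1 ^ 2 ≤
      β n * (κ * G ^ 2 * ∑ i, β i * (‖residual h z q i‖ + s) ^ 2) := by
    have h1 : ∑ i : Set.Iio n, B i.1 ^ 2 ≤
        ∑ i : Set.Iio n, β n * κ * G ^ 2 * (β i.1 * (‖residual h z q i.1‖ + s) ^ 2) := by
      refine Finset.sum_le_sum fun i _ => ?_
      have := hβ i.1
      calc B i.1 ^ 2 = β i.1 * (G ^ 2 * (β i.1 * (‖residual h z q i.1‖ + s) ^ 2)) := by
            rw [hB]; ring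
        _ ≤ κ * β n * (G ^ 2 * (β i.1 * (‖residual h z q i.1‖ + s) ^ 2)) :=
            mul_le_mul_of_nonneg_right (hst.β_le_β i.1 n i.2) (by positivity)
        _ = _ := by ring
    refine h1.trans ?_
    rw [← Finset.mul_sum]
    have h2 : ∑ i : Set.Iio n, β i.1 * (‖residual h z q i.1‖ + s) ^ 2 ≤
        ∑ i, β i * (‖residual h z q i‖ + s) ^ 2 :=
      sum_Iio_le_sum n (f := fun i => β i * (‖residual h z q i‖ + s) ^ 2) fun i => by
        have := hβ i; positivity
    have := hβ n
    calc _ ≤ β n * κ * G ^ 2 * ∑ i, β i * (‖residual h z q i‖ + s) ^ 2 := by gcongr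
      _ = _ := by ring
  set T := α * (‖z - xs‖ + (s + ρ)) ^ 2 + ∑ i, β i * (‖residual h z q i‖ + s) ^ 2 with hT
  have hβn := hβ n
  have hbm : β n * m ≤ 1 := hst.β_le n
  have hδ3 : (1 + 1 / (β n * m / 2)) * ‖δ‖ ^ 2 ≤ κ * shiftConst N m G M * T := by
    have h1 : ‖δ‖ ^ 2 ≤ β n * (M ^ 2 * (2 * (N + 1) * (κ * G ^ 2 * T))) := by
      refine hδ2.trans ?_
      have : A ^ 2 + ∑ i : Set.Iio n, B i.1 ^ 2 ≤ β n * (κ * G ^ 2 * T) := by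
        rw [hT]; linarith
      calc _ ≤ M ^ 2 * (2 * (N + 1) * (β n * (κ * G ^ 2 * T))) := by gcongr
        _ = _ := by ring
    have h2 : 1 + 1 / (β n * m / 2) ≤ 3 / (β n * m) := by
      rw [show (3 : ℝ) / (β n * m) = 1 / (β n * m) + 1 / (β n * m / 2) by field_simp; norm_num]
      have : 1 ≤ 1 / (β n * m) := by rw [le_div_iff₀ (by positivity)]; linarith
      linarith
    calc _ ≤ 3 / (β n * m) * (β n * (M ^ 2 * (2 * (N + 1) * (κ * G ^ 2 * T)))) :=
          mul_le_mul h2 h1 (by positivity) (by positivity)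
      _ = _ := by unfold shiftConst; field_simp; ring
  have ha := norm_sub_smul_sq_le hm hβn.le (hst.β_small n)
    (ops.le_inner_secondaryDrift x z y q n) (ops.norm_secondaryDrift_le x z y q n)
  have ha' : (1 + β n * m / 2) * ‖a‖ ^ 2 ≤ (1 - β n * m / 2) * ‖residual h z q n‖ ^ 2 +
      2 * β n * pertConst m G * s ^ 2 := by
    have hp : 0 ≤ pertConst m G := by unfold pertConst; positivity
    have h1 : ‖a‖ ^ 2 ≤ (1 - β n * m) * ‖residual h z q n‖ ^ 2 +
      β n * pertConst m G * s ^ 2 := ha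
    have h2 : 0 ≤ β n * pertConst m G * s ^ 2 := by positivity
    have h3 : 0 ≤ (β n * m) ^ 2 * ‖residual h z q n‖ ^ 2 := by positivity
    have h4 : (1 + β n * m / 2) * (β n * pertConst m G * s ^ 2) ≤
        2 * (β n * pertConst m G * s ^ 2) := mul_le_mul_of_nonneg_right (by linarith) h2
    have h5 := mul_le_mul_of_nonneg_left h1 (show 0 ≤ 1 + β n * m / 2 by positivity)
    nlinarith
  rw [e]
  have hw := norm_add_sq_le_weighted a δ (show 0 < β n * m / 2 by positivity)
  linarith

-- The residuals supply a decay `(m/2) ∑ β_n ‖r_n‖²` on their fast scales, and the main error a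
-- decay `α μ₀ ‖z - x^*‖²`. Every coupling term is `κ` times one of these, or else a multiple of the
-- squared gap.
set_option maxHeartbeats 1000000 in
theorem lyapunov_step (ops : RegularOps μ₀ m ℓ₀ L M v h xs) {κ α : ℝ} {β : Fin N → ℝ}
    (hκ : RatioSmall N μ₀ m (growth N μ₀ ℓ₀ L M) M κ)
    (hst : StepSmall μ₀ m (growth N μ₀ ℓ₀ L M) κ α β) (x z z' : Vec d₀) (y q q' : Tuple d)
    (hz : z' = z - α • mainDrift μ₀ v x y z)
    (hq : ∀ n, q' n = q n - β n • secondaryDrift μ₀ h x y q n) :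
    lyapunov h xs z' q' ≤ (1 - α * μ₀ / 2) * lyapunov h xs z q +
      lyapunovConst N μ₀ m (growth N μ₀ ℓ₀ L M) M * (α + ∑ n, β n) * gap x y z q ^ 2 := by
  have hμ := ops.μ₀_pos
  have hm := ops.m_pos
  have hκ0 := hκ.pos
  have hκ1 := hκ.le_one
  have hstep := ops.residual_step hst x z z' y q q' hz hq hκ0
  have hmain := norm_sub_smul_sq_le (r := z - xs) hμ hst.α_pos.le hst.α_small
    (ops.le_inner_mainDrift x z y q) (ops.norm_mainDrift_le x z y q)
  set G := growth N μ₀ ℓ₀ L M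
  have hG : 0 < G := ops.growth_pos
  set s := gap x y z q
  have hs0 : 0 ≤ s := gap_nonneg x y z q
  set r : Fin N → ℝ := fun i => ‖residual h z q i‖ with hr
  set u := ‖z - xs‖ with hu
  set ρ := ∑ i, ‖residual h z q i‖ with hρ
  have hα := hst.α_pos
  have hβ := hst.β_pos
  set b := ∑ n, β n with hb
  have hb0 : 0 ≤ b := Finset.sum_nonneg fun n _ => (hβ n).le
  set Y := ∑ n, β n * r n ^ 2 with hY
  have hY0 : 0 ≤ Y := Finset.sum_nonneg fun n _ => by have := hβ n; positivity
  set R := ∑ n, r n ^ 2 with hR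
  have hR0 : 0 ≤ R := by positivity
  set K1 := pertConst m G
  set K2 := shiftConst N m G M
  set K3 := pertConst μ₀ G
  have hK1 : 0 ≤ K1 := by unfold K1 pertConst; positivity
  have hK2 : 0 ≤ K2 := by unfold K2 shiftConst; positivity
  have hK3 : 0 ≤ K3 := by unfold K3 pertConst; positivity
  -- Separation of scales: residual terms weighted by the slow step `α` are paid from the fast decay
  -- `Y`.
  have hαR : α * R ≤ κ * Y := by
    rw [hR, hY, Finset.mul_sum, Finset.mul_sum]
    refine Finset.sum_le_sum fun n _ => ?_
    have := mul_le_mul_of_nonneg_right (hst.α_le_β n) (sq_nonneg (r n))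
    linarith
  have hρ2 : ρ ^ 2 ≤ N * R := by
    have := sq_sum_le_card_mul_sum_sq (s := Finset.univ) (f := r)
    simpa using this
  have hαρ : α * ρ ^ 2 ≤ κ * N * Y := by
    calc α * ρ ^ 2 ≤ α * (N * R) := by gcongr
      _ = N * (α * R) := by ring
      _ ≤ N * (κ * Y) := by gcongr
      _ = _ := by ring
  have hNY : κ * N * Y ≤ N * Y := by
    rw [mul_assoc]; exact mul_le_of_le_one_left (by positivity) hκ1
  set T := α * (u + (s + ρ)) ^ 2 + ∑ i, β i * (r i + s) ^ 2 with hT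
  have hTle : T ≤ 3 * α * u ^ 2 + (3 * N + 2) * Y + 3 * (α + b) * s ^ 2 := by
    have h1 : (u + (s + ρ)) ^ 2 ≤ 3 * u ^ 2 + 3 * s ^ 2 + 3 * ρ ^ 2 := by
      linarith only [sq_nonneg (u - s), sq_nonneg (u - ρ), sq_nonneg (s - ρ)]
    have h2 : ∑ i, β i * (r i + s) ^ 2 ≤ 2 * Y + 2 * b * s ^ 2 := by
      rw [hY, hb, Finset.mul_sum, Finset.mul_sum, Finset.sum_mul, ← Finset.sum_add_distrib]
      refine Finset.sum_le_sum fun i _ => ?_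
      have : (r i + s) ^ 2 ≤ 2 * r i ^ 2 + 2 * s ^ 2 := by linarith only [sq_nonneg (r i - s)]
      have := mul_le_mul_of_nonneg_left this (hβ i).le
      linarith
    have h3 := mul_le_mul_of_nonneg_left h1 hα.le
    have h4 : 0 ≤ b * s ^ 2 := by positivity
    rw [hT]
    linarith
  have hsum : ∑ n, ‖residual h z' q' n‖ ^ 2 ≤
      R - m / 2 * Y + 2 * K1 * b * s ^ 2 + N * (κ * K2 * T) := by
    refine (Finset.sum_le_sum fun n _ => hstep n).trans (le_of_eq ?_)
    rw [Finset.sum_add_distrib, Finset.sum_add_distrib]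
    simp only [Finset.sum_const, Finset.card_univ, Fintype.card_fin, nsmul_eq_mul]
    rw [hR, hY, hb, Finset.mul_sum, Finset.mul_sum, Finset.sum_mul, ← Finset.sum_sub_distrib]
    congr 2
    · exact Finset.sum_congr rfl fun n _ => by ring
    · exact Finset.sum_congr rfl fun n _ => by ring
  have hmain' : ‖z' - xs‖ ^ 2 ≤ (1 - α * μ₀) * u ^ 2 + α * K3 * (s + ρ) ^ 2 := by
    rw [hz, sub_right_comm]
    exact hmain
  have hsρ : α * K3 * (s + ρ) ^ 2 ≤ 2 * K3 * α * s ^ 2 + 2 * K3 * N * (κ * Y) := by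
    have h1 : (s + ρ) ^ 2 ≤ 2 * s ^ 2 + 2 * ρ ^ 2 := by linarith only [sq_nonneg (s - ρ)]
    have h2 := mul_le_mul_of_nonneg_left h1 (show 0 ≤ α * K3 by positivity)
    have h3 := mul_le_mul_of_nonneg_left hαρ hK3
    linarith only [h2, h3]
  have hNT : N * (κ * K2 * T) ≤ κ * (3 * N * K2) * (α * u ^ 2) +
      κ * (N * K2 * (3 * N + 2)) * Y + 3 * N * K2 * (α + b) * s ^ 2 := by
    have h1 := mul_le_mul_of_nonneg_left hTle (show 0 ≤ N * (κ * K2) by positivity)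
    have h2 : κ * (3 * N * K2 * (α + b) * s ^ 2) ≤ 3 * N * K2 * (α + b) * s ^ 2 :=
      mul_le_of_le_one_left (by positivity) hκ1
    linarith only [h1, h2]
  -- The budget: coupling consumes half of the decay `α μ₀ u²` and half of `(m/2) Y`; the remaining
  -- `(m/4) Y` dominates `(α μ₀ / 2) R`, so the residuals too contract at the main rate.
  have c1 := mul_le_mul_of_nonneg_right hκ.main (show 0 ≤ α * u ^ 2 by positivity)
  have c2 := mul_le_mul_of_nonneg_right hκ.secondary hY0
  have c3 := mul_le_mul_of_nonneg_right hκ.rate hY0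
  have c4 := mul_le_mul_of_nonneg_left hαR hμ.le
  have p1 : 0 ≤ K1 * α * s ^ 2 := by positivity
  have p2 : 0 ≤ K3 * b * s ^ 2 := by positivity
  change ‖z' - xs‖ ^ 2 + ∑ n, ‖residual h z' q' n‖ ^ 2 ≤ (1 - α * μ₀ / 2) * (u ^ 2 + R) +
    (2 * K1 + 2 * K3 + 3 * N * K2) * (α + b) * s ^ 2
  linarith only [hmain', hsρ, hsum, hNT, c1, c2, c3, c4, p1, p2]

end RegularOps

end Step

/-! ### Operator values and final errors in terms of the Lyapunov function and the gap. -/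

section Bounds

variable {N d₀ : ℕ} {d : Fin N → ℕ} {μ₀ m ℓ₀ L M : ℝ} {v : Vec d₀ → Tuple d → Vec d₀}
  {h : SecondaryOps d₀ d} {xs : Vec d₀}

/-- The squared distance between `(x, y)` and `(z, q)`. -/
noncomputable def gapSq (x : Vec d₀) (y : Tuple d) (z : Vec d₀) (q : Tuple d) : ℝ :=
  ‖x - z‖ ^ 2 + ∑ n, ‖y n - q n‖ ^ 2

theorem add_sum_sq_le_card (a : ℝ) (b : Fin N → ℝ) :
    (a + ∑ i, b i) ^ 2 ≤ (N + 1) * (a ^ 2 + ∑ i, b i ^ 2) := by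
  have := sq_sum_le_card_mul_sum_sq (s := Finset.univ) (f := (Fin.cons a b : Fin (N + 1) → ℝ))
  simpa [Fin.sum_univ_succ] using this

theorem gap_sq_le (x : Vec d₀) (y : Tuple d) (z : Vec d₀) (q : Tuple d) :
    gap x y z q ^ 2 ≤ (N + 1) * gapSq x y z q :=
  add_sum_sq_le_card _ _

theorem lyapunov_nonneg (h : SecondaryOps d₀ d) (xs z : Vec d₀) (q : Tuple d) :
    0 ≤ lyapunov h xs z q := by
  unfold lyapunov; positivity

theorem total_sq_le (h : SecondaryOps d₀ d) (xs x z : Vec d₀) (y q : Tuple d) :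
    (‖z - xs‖ + (gap x y z q + ∑ i, ‖residual h z q i‖)) ^ 2 ≤
      2 * (N + 1) * (lyapunov h xs z q + gapSq x y z q) := by
  have h1 := add_sum_sq_le_card ‖z - xs‖ (fun i => ‖residual h z q i‖)
  have h2 := gap_sq_le x y z q
  have h3 : (‖z - xs‖ + (gap x y z q + ∑ i, ‖residual h z q i‖)) ^ 2 ≤
      2 * (‖z - xs‖ + ∑ i, ‖residual h z q i‖) ^ 2 + 2 * gap x y z q ^ 2 := by
    linarith only [sq_nonneg (‖z - xs‖ + ∑ i, ‖residual h z q i‖ - gap x y z q)]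
  unfold lyapunov
  linarith

/-- If `t` is at most `A` times the total error then `t²` is bounded by the squared errors. -/
theorem sq_le_of_le_total (h : SecondaryOps d₀ d) (xs x z : Vec d₀) (y q : Tuple d) {t A : ℝ}
    (ht0 : 0 ≤ t) (ht : t ≤ A * (‖z - xs‖ + (gap x y z q + ∑ i, ‖residual h z q i‖))) :
    t ^ 2 ≤ 2 * (N + 1) * A ^ 2 * (lyapunov h xs z q + gapSq x y z q) := by
  calc t ^ 2 ≤ (A * (‖z - xs‖ + (gap x y z q + ∑ i, ‖residual h z q i‖))) ^ 2 :=
        pow_le_pow_left₀ ht0 ht 2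
    _ = A ^ 2 * (‖z - xs‖ + (gap x y z q + ∑ i, ‖residual h z q i‖)) ^ 2 := by ring
    _ ≤ A ^ 2 * (2 * (N + 1) * (lyapunov h xs z q + gapSq x y z q)) :=
        mul_le_mul_of_nonneg_left (total_sq_le h xs x z y q) (sq_nonneg A)
    _ = _ := by ring

/-- The squared operator values are bounded by this multiple of the squared errors. -/
noncomputable def valueConst (N : ℕ) (μ₀ ℓ₀ L M : ℝ) : ℝ :=
  2 * (N + 1) * (growth N μ₀ ℓ₀ L M + μ₀) ^ 2

/-- The factor of the expected errors in the second moments of the noises. -/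
noncomputable def noiseConst (c : Constants N) (μ₀ ℓ₀ L M : ℝ) : ℝ :=
  (c.ω₀ + c.ω₁ + N * c.ω₂) * valueConst N μ₀ ℓ₀ L M

/-- The squared distances to the fixed points are bounded by this multiple of the squared
errors. -/
noncomputable def errorConst (N : ℕ) (M : ℝ) : ℝ :=
  2 * (N + 1) * ((1 + M) ^ (N + 1)) ^ 2

namespace RegularOps

theorem norm_main_sq_le (ops : RegularOps μ₀ m ℓ₀ L M v h xs) (x z : Vec d₀) (y q : Tuple d) :
    ‖v x y‖ ^ 2 ≤ valueConst N μ₀ ℓ₀ L M * (lyapunov h xs z q + gapSq x y z q) := by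
  refine sq_le_of_le_total h xs x z y q (norm_nonneg _) ?_
  have h1 := ops.norm_mainDrift_le x z y q
  have h2 := norm_fst_le_gap x y z q
  have h3 : ‖v x y‖ ≤ ‖v x y - μ₀ • (x - z)‖ + μ₀ * ‖x - z‖ := by
    have := norm_add_le (v x y - μ₀ • (x - z)) (μ₀ • (x - z))
    rwa [sub_add_cancel, norm_smul, Real.norm_of_nonneg ops.μ₀_pos.le] at this
  have h4 : ‖x - z‖ ≤ ‖z - xs‖ + (gap x y z q + ∑ i, ‖residual h z q i‖) := by
    have : 0 ≤ ∑ i, ‖residual h z q i‖ := by positivity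
    linarith [norm_nonneg (z - xs)]
  have := mul_le_mul_of_nonneg_left h4 ops.μ₀_pos.le
  linarith

theorem norm_secondary_sq_le (ops : RegularOps μ₀ m ℓ₀ L M v h xs) (x z : Vec d₀)
    (y q : Tuple d) (n : Fin N) :
    ‖h n x (prev n y) (y n)‖ ^ 2 ≤
      valueConst N μ₀ ℓ₀ L M * (lyapunov h xs z q + gapSq x y z q) := by
  refine sq_le_of_le_total h xs x z y q (norm_nonneg _) ?_
  have h1 := ops.norm_secondaryDrift_le x z y q n
  have h2 := norm_snd_le_gap x y z q n
  have h0 := gap_nonneg x y z q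
  have h3 : ‖h n x (prev n y) (y n)‖ ≤ ‖h n x (prev n y) (y n) - μ₀ • (y n - q n)‖
      + μ₀ * ‖y n - q n‖ := by
    have := norm_add_le (h n x (prev n y) (y n) - μ₀ • (y n - q n)) (μ₀ • (y n - q n))
    rwa [sub_add_cancel, norm_smul, Real.norm_of_nonneg ops.μ₀_pos.le] at this
  have hr := norm_residual_le_sum h z q n
  have h4 : ‖y n - q n‖ ≤ ‖z - xs‖ + (gap x y z q + ∑ i, ‖residual h z q i‖) := by
    have : 0 ≤ ∑ i, ‖residual h z q i‖ := by positivity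
    linarith [norm_nonneg (z - xs)]
  have h5 : ‖residual h z q n‖ + gap x y z q ≤
      ‖z - xs‖ + (gap x y z q + ∑ i, ‖residual h z q i‖) := by
    linarith [norm_nonneg (z - xs)]
  have h6 := mul_le_mul_of_nonneg_left h4 ops.μ₀_pos.le
  have h7 := mul_le_mul_of_nonneg_left h5 ops.growth_pos.le
  linarith

theorem norm_sub_sol_sq_le (ops : RegularOps μ₀ m ℓ₀ L M v h xs) (x z : Vec d₀)
    (y q : Tuple d) :
    ‖x - xs‖ ^ 2 ≤ errorConst N M * (lyapunov h xs z q + gapSq x y z q) := by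
  have hM := ops.M_pos
  refine sq_le_of_le_total h xs x z y q (norm_nonneg _) ?_
  have h1 : (1 : ℝ) ≤ (1 + M) ^ (N + 1) := one_le_pow₀ (by linarith)
  have h2 := norm_fst_le_gap x y z q
  have h3 := norm_sub_le_norm_sub_add_norm_sub x z xs
  have h4 : 0 ≤ ∑ i, ‖residual h z q i‖ := by positivity
  have h5 := gap_nonneg x y z q
  have h6 := le_mul_of_one_le_left
    (show 0 ≤ ‖z - xs‖ + (gap x y z q + ∑ i, ‖residual h z q i‖) by positivity) h1
  linarith

theorem norm_residual_sq_le (ops : RegularOps μ₀ m ℓ₀ L M v h xs) (x z : Vec d₀)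
    (y q : Tuple d) (n : Fin N) :
    ‖residual h x y n‖ ^ 2 ≤ errorConst N M * (lyapunov h xs z q + gapSq x y z q) := by
  have hM := ops.M_pos
  refine sq_le_of_le_total h xs x z y q (norm_nonneg _) ?_
  have h1 : 1 + M ≤ (1 + M) ^ (N + 1) := by
    simpa using pow_le_pow_right₀ (show (1 : ℝ) ≤ 1 + M by linarith) (show 1 ≤ N + 1 by omega)
  have h2 := ops.norm_sub_yStar_le x z y q n
  have h3 := norm_residual_le_sum h z q n
  have h4 : 0 ≤ ∑ i, ‖residual h z q i‖ := by positivity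
  have h5 := gap_nonneg x y z q
  have h6 := mul_le_mul_of_nonneg_right h1
    (show 0 ≤ ‖z - xs‖ + (gap x y z q + ∑ i, ‖residual h z q i‖) by positivity)
  have h7 : 0 ≤ M * ‖z - xs‖ := by positivity
  have h8 : 0 ≤ M * ∑ i, ‖residual h z q i‖ := by positivity
  unfold residual at *
  linarith [norm_nonneg (z - xs)]

theorem norm_sub_yDiamond_sol_sq_le (ops : RegularOps μ₀ m ℓ₀ L M v h xs) (x z : Vec d₀)
    (y q : Tuple d) (n : Fin N) :
    ‖y n - yDiamond h xs n‖ ^ 2 ≤ errorConst N M * (lyapunov h xs z q + gapSq x y z q) := by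
  have hM := ops.M_pos
  refine sq_le_of_le_total h xs x z y q (norm_nonneg _) ?_
  have h1 : (1 : ℝ) ≤ (1 + M) ^ N := one_le_pow₀ (by linarith)
  have h2 := norm_snd_le_gap x y z q n
  have h3 := ops.norm_sub_yDiamond_le z q n
  have h4 := ops.norm_yDiamond_sub_le z xs n
  have h5 := norm_sub_le_norm_sub_add_norm_sub (y n) (q n) (yDiamond h xs n)
  have h6 := norm_sub_le_norm_sub_add_norm_sub (q n) (yDiamond h z n) (yDiamond h xs n)
  have h7 := gap_nonneg x y z q
  set P := (1 + M) ^ N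
  have h8 := mul_le_mul_of_nonneg_right h1 h7
  have p1 : 0 ≤ P * ‖z - xs‖ := by positivity
  have p2 : 0 ≤ P * M * gap x y z q := by positivity
  have p3 : 0 ≤ P * M * ∑ i, ‖residual h z q i‖ := by positivity
  rw [pow_succ]
  linarith

end RegularOps

end Bounds

/-! ### Filtered noise, orthogonality and integrability. -/

section Probability

variable {Ω : Type*} {mΩ : MeasurableSpace Ω} {P : Measure Ω}

theorem integrable_inner_of_memLp_two {E : Type*} [NormedAddCommGroup E] [InnerProductSpace ℝ E]
    {f g : Ω → E} (hf : MemLp f 2 P) (hg : MemLp g 2 P) :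
    Integrable (fun w => inner ℝ (f w) (g w)) P := by
  have h1 := (hf.integrable_norm_pow two_ne_zero).add (hg.integrable_norm_pow two_ne_zero)
  refine h1.mono' (hf.1.inner hg.1) (Filter.Eventually.of_forall fun w => ?_)
  have := abs_real_inner_le_norm (f w) (g w)
  simp only [Pi.add_apply, Real.norm_eq_abs]
  nlinarith [sq_nonneg (‖f w‖ - ‖g w‖), norm_nonneg (f w), norm_nonneg (g w)]

/-- The autoregressive filter `w^{k+1} = (1 - λ γ^k) w^k - γ^k ζ^k`, `w^0 = 0`, of a noise
sequence. -/
def filteredNoise {E : Type*} [AddCommGroup E] [Module ℝ E] (l : ℝ) (γ : ℕ → ℝ)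
    (ζ : ℕ → Ω → E) : ℕ → Ω → E
  | 0, _ => 0
  | k + 1, w => (1 - l * γ k) • filteredNoise l γ ζ k w - γ k • ζ k w

theorem memLp_filteredNoise {E : Type*} [NormedAddCommGroup E] [InnerProductSpace ℝ E]
    {l : ℝ} {γ : ℕ → ℝ} {ζ : ℕ → Ω → E} {K : ℕ} (hζ : ∀ k < K, MemLp (ζ k) 2 P) :
    ∀ k ≤ K, MemLp (filteredNoise l γ ζ k) 2 P := by
  intro k
  induction k with
  | zero => intro _; exact MemLp.zero
  | succ k ih =>
    intro hk
    exact ((ih (by omega)).const_smul _).sub ((hζ k (by omega)).const_smul _)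

variable [IsProbabilityMeasure P]

theorem integral_inner_eq_zero_of_condExp {E : Type*} [NormedAddCommGroup E]
    [InnerProductSpace ℝ E] [CompleteSpace E] {m : MeasurableSpace Ω} (hm : m ≤ mΩ)
    {f g : Ω → E} (hf : MemLp f 2 P) (hg : MemLp g 2 P) (hfm : AEStronglyMeasurable[m] f P)
    (h0 : P[g | m] =ᵐ[P] 0) : ∫ w, inner ℝ (f w) (g w) ∂P = 0 := by
  have h1 : P[fun w => inner ℝ (f w) (g w) | m] =ᵐ[P] fun w => inner ℝ (f w) ((P[g | m]) w) :=
    condExp_bilin_of_aestronglyMeasurable_left (innerSL ℝ) hfm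
      (integrable_inner_of_memLp_two hf hg) (hg.integrable (by norm_num))
  rw [← integral_condExp hm, integral_congr_ae h1]
  refine integral_eq_zero_of_ae ?_
  filter_upwards [h0] with w hw
  simp [hw]

theorem integral_norm_sq_le_of_condVariance {r : ℕ} {m : MeasurableSpace Ω} (hm : m ≤ mΩ)
    {g : Ω → Vec r} (h0 : P[g | m] =ᵐ[P] 0) {B : Ω → ℝ}
    (hB : Integrable B P) (h : ∀ᵐ w ∂P, condVariance m P g w ≤ B w) :
    ∫ w, ‖g w‖ ^ 2 ∂P ≤ ∫ w, B w ∂P := by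
  have h1 : (fun w => ‖g w - (P[g | m]) w‖ ^ 2) =ᵐ[P] fun w => ‖g w‖ ^ 2 := by
    filter_upwards [h0] with w hw
    simp [hw]
  have h2 : condVariance m P g =ᵐ[P] P[fun w => ‖g w‖ ^ 2 | m] := condExp_congr_ae h1
  rw [← integral_condExp hm (f := fun w => ‖g w‖ ^ 2)]
  refine integral_mono_ae integrable_condExp hB ?_
  filter_upwards [h, h2] with w hw hw2
  rw [← hw2]
  exact hw

/-- The filter state is measurable for the past and the new noise is centred given the past, so the
cross term vanishes and the noise contributes only at order `γ²`. -/
theorem integral_filteredNoise_step {E : Type*} [NormedAddCommGroup E]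
    [InnerProductSpace ℝ E] [CompleteSpace E] {m : MeasurableSpace Ω} (hm : m ≤ mΩ)
    {l : ℝ} {γ : ℕ → ℝ} {ζ : ℕ → Ω → E} {k : ℕ} (hl : 0 ≤ l * γ k) (hl1 : l * γ k ≤ 1)
    (hf : MemLp (filteredNoise l γ ζ k) 2 P) (hg : MemLp (ζ k) 2 P)
    (hfm : AEStronglyMeasurable[m] (filteredNoise l γ ζ k) P) (h0 : P[ζ k | m] =ᵐ[P] 0) :
    ∫ w, ‖filteredNoise l γ ζ (k + 1) w‖ ^ 2 ∂P ≤
      (1 - l * γ k) * ∫ w, ‖filteredNoise l γ ζ k w‖ ^ 2 ∂P +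
        γ k ^ 2 * ∫ w, ‖ζ k w‖ ^ 2 ∂P := by
  set f := filteredNoise l γ ζ k
  set a := 1 - l * γ k
  have e : ∀ w, ‖filteredNoise l γ ζ (k + 1) w‖ ^ 2 =
      a ^ 2 * ‖f w‖ ^ 2 + γ k ^ 2 * ‖ζ k w‖ ^ 2 - 2 * a * γ k * inner ℝ (f w) (ζ k w) := by
    intro w
    change ‖a • f w - γ k • ζ k w‖ ^ 2 = _
    rw [norm_sub_sq_real, norm_smul, norm_smul, mul_pow, mul_pow, real_inner_smul_left,
      real_inner_smul_right, Real.norm_eq_abs, Real.norm_eq_abs, sq_abs, sq_abs]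
    ring
  simp_rw [e]
  have i1 := (hf.integrable_norm_pow two_ne_zero).const_mul (a ^ 2)
  have i2 := (hg.integrable_norm_pow two_ne_zero).const_mul (γ k ^ 2)
  have i3 := (integrable_inner_of_memLp_two hf hg).const_mul (2 * a * γ k)
  have i12 : Integrable (fun w => a ^ 2 * ‖f w‖ ^ 2 + γ k ^ 2 * ‖ζ k w‖ ^ 2) P := i1.add i2
  rw [integral_sub i12 i3, integral_add i1 i2, integral_const_mul, integral_const_mul,
    integral_const_mul, integral_inner_eq_zero_of_condExp hm hf hg hfm h0, mul_zero, sub_zero]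
  have ha : a ^ 2 ≤ a := by
    have h0 : 0 ≤ a := by simp only [a]; linarith
    have h1 : a ≤ 1 := by simp only [a]; linarith
    nlinarith
  have : 0 ≤ ∫ w, ‖f w‖ ^ 2 ∂P := integral_nonneg fun w => by positivity
  have := mul_le_mul_of_nonneg_right ha this
  linarith

variable {N d₀ : ℕ} {d : Fin N → ℕ} {μ₀ m ℓ₀ L M : ℝ} {v : Vec d₀ → Tuple d → Vec d₀}
  {h : SecondaryOps d₀ d} {xs : Vec d₀}

namespace RegularOps

theorem continuous_residual (ops : RegularOps μ₀ m ℓ₀ L M v h xs) (n : Fin N) :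
    Continuous fun z : Vec d₀ × Tuple d => residual h z.1 z.2 n := by
  have h1 : Continuous fun z : Vec d₀ × Prev d n => yStar h n z.1 z.2 :=
    continuous_of_norm_sub_le (ops.star n)
  have h2 : Continuous fun z : Vec d₀ × Tuple d => yStar h n z.1 (prev n z.2) :=
    h1.comp (continuous_fst.prodMk ((continuous_prev n).comp continuous_snd))
  exact ((continuous_apply n).comp continuous_snd).sub h2

/-- The fixed-point map is Lipschitz, hence of linear growth; its value at the origin is the
constant in the bound. -/
theorem memLp_residual (ops : RegularOps μ₀ m ℓ₀ L M v h xs) {X : Ω → Vec d₀} {Y : Ω → Tuple d}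
    (hX : MemLp X 2 P) (hY : ∀ n, MemLp (fun w => Y w n) 2 P) (hXm : Measurable X)
    (hYm : Measurable Y) (n : Fin N) : MemLp (fun w => residual h (X w) (Y w) n) 2 P := by
  have hmeas : Measurable fun w => residual h (X w) (Y w) n :=
    (ops.continuous_residual n).measurable.comp (hXm.prodMk hYm)
  have hbd : MemLp (fun w => ‖Y w n‖ + ‖yStar h n 0 0‖ + M * (‖X w‖ + ∑ i, ‖Y w i‖)) 2 P :=
    ((hY n).norm.add (memLp_const _)).add
      ((hX.norm.add (memLp_finsetSum _ fun i _ => (hY i).norm)).const_mul M)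
  refine hbd.mono' hmeas.aestronglyMeasurable (Filter.Eventually.of_forall fun w => ?_)
  have h1 := ops.star n (X w) 0 (prev n (Y w)) 0
  have h2 : ‖X w - 0‖ + ∑ i, ‖prev n (Y w) i - (0 : Prev d n) i‖ ≤ ‖X w‖ + ∑ i, ‖Y w i‖ := by
    simp only [sub_zero, Pi.zero_apply]
    exact add_le_add_right
      (sum_Iio_le_sum n (f := fun i => ‖Y w i‖) fun _ => norm_nonneg _) _
  have h3 := mul_le_mul_of_nonneg_left h2 ops.M_pos.le
  have h4 := norm_le_norm_sub_add (yStar h n (X w) (prev n (Y w))) (yStar h n 0 0)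
  have h5 := norm_sub_le (Y w n) (yStar h n (X w) (prev n (Y w)))
  unfold residual
  linarith

theorem integrable_lyapunov (ops : RegularOps μ₀ m ℓ₀ L M v h xs) {X : Ω → Vec d₀}
    {Y : Ω → Tuple d} (hX : MemLp X 2 P) (hY : ∀ n, MemLp (fun w => Y w n) 2 P)
    (hXm : Measurable X) (hYm : Measurable Y) :
    Integrable (fun w => lyapunov h xs (X w) (Y w)) P :=
  ((hX.sub (memLp_const xs)).integrable_norm_pow two_ne_zero).add
    (integrable_finsetSum _ fun n _ =>
      (ops.memLp_residual hX hY hXm hYm n).integrable_norm_pow two_ne_zero)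

theorem memLp_secondary (ops : RegularOps μ₀ m ℓ₀ L M v h xs)
    (hcont : ∀ n, Continuous fun z : (Vec d₀ × Prev d n) × Vec (d n) => h n z.1.1 z.1.2 z.2)
    {X : Ω → Vec d₀} {Y : Ω → Tuple d}
    (hX : MemLp X 2 P) (hY : ∀ n, MemLp (fun w => Y w n) 2 P) (hXm : Measurable X)
    (hYm : Measurable Y) (n : Fin N) :
    MemLp (fun w => h n (X w) (prev n (Y w)) (Y w n)) 2 P := by
  have hmeas : Measurable fun w => h n (X w) (prev n (Y w)) (Y w n) :=
    (hcont n).measurable.comp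
      ((hXm.prodMk ((continuous_prev n).measurable.comp hYm)).prodMk
        ((measurable_pi_apply n).comp hYm))
  exact ((ops.memLp_residual hX hY hXm hYm n).norm.const_mul L).mono' hmeas.aestronglyMeasurable
    (Filter.Eventually.of_forall fun w => ops.norm_secondary_le (X w) (Y w) n)

/-- The growth bound is `norm_mainDrift_le` with `z = x`, `q = y`, where the gap vanishes. -/
theorem memLp_main (ops : RegularOps μ₀ m ℓ₀ L M v h xs)
    (hv : Measurable fun z : Vec d₀ × Tuple d => v z.1 z.2)
    {X : Ω → Vec d₀} {Y : Ω → Tuple d}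
    (hX : MemLp X 2 P) (hY : ∀ n, MemLp (fun w => Y w n) 2 P) (hXm : Measurable X)
    (hYm : Measurable Y) : MemLp (fun w => v (X w) (Y w)) 2 P := by
  have hmeas : Measurable fun w => v (X w) (Y w) := hv.comp (hXm.prodMk hYm)
  have hbd : MemLp (fun w => growth N μ₀ ℓ₀ L M *
      (‖X w - xs‖ + ∑ i, ‖residual h (X w) (Y w) i‖)) 2 P :=
    ((hX.sub (memLp_const xs)).norm.add
      (memLp_finsetSum _ fun i _ => (ops.memLp_residual hX hY hXm hYm i).norm)).const_mul _
  refine hbd.mono' hmeas.aestronglyMeasurable (Filter.Eventually.of_forall fun w => ?_)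
  simpa [gap] using ops.norm_mainDrift_le (X w) (X w) (Y w) (Y w)

end RegularOps

end Probability

/-! ### Moment recursions along a run. -/

section Run

variable {Ω : Type*}

/-- The filtered noise of the secondary sequences. -/
def filteredNoiseTuple {N : ℕ} {d : Fin N → ℕ} (l : ℝ) (β : ℕ → Fin N → ℝ)
    (ψ : ℕ → Ω → Tuple d) (k : ℕ) (w : Ω) : Tuple d :=
  fun n => filteredNoise l (fun k => β k n) (fun k w => ψ k w n) k w

/-- The main sequence without its filtered noise. -/
def cleanMain {d₀ : ℕ} (l : ℝ) (α : ℕ → ℝ) (x ξ : ℕ → Ω → Vec d₀) (k : ℕ) (w : Ω) : Vec d₀ :=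
  x k w - filteredNoise l α ξ k w

/-- The secondary sequences without their filtered noises. -/
def cleanSecondary {N : ℕ} {d : Fin N → ℕ} (l : ℝ) (β : ℕ → Fin N → ℝ)
    (y ψ : ℕ → Ω → Tuple d) (k : ℕ) (w : Ω) : Tuple d :=
  fun n => y k w n - filteredNoiseTuple l β ψ k w n

theorem gapSq_clean {N d₀ : ℕ} {d : Fin N → ℕ} {μ₀ : ℝ} {α : ℕ → ℝ} {β : ℕ → Fin N → ℝ}
    {x : ℕ → Ω → Vec d₀} {y : ℕ → Ω → Tuple d} {ξ : ℕ → Ω → Vec d₀} {ψ : ℕ → Ω → Tuple d}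
    (k : ℕ) (w : Ω) :
    gapSq (x k w) (y k w) (cleanMain μ₀ α x ξ k w) (cleanSecondary μ₀ β y ψ k w) =
      ‖filteredNoise μ₀ α ξ k w‖ ^ 2 + ∑ n, ‖filteredNoiseTuple μ₀ β ψ k w n‖ ^ 2 := by
  simp [gapSq, cleanMain, cleanSecondary]

variable {N d₀ : ℕ} {d : Fin N → ℕ}

theorem measurable_history_main (x : ℕ → Ω → Vec d₀) (y : ℕ → Ω → Tuple d) {l k : ℕ}
    (hl : l ≤ k) : Measurable[history x y k] (x l) := by
  have h1 := comap_measurable (m := inferInstance) (x l)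
  refine h1.mono ?_ le_rfl
  exact le_sup_left.trans (le_iSup (fun l : Fin (k + 1) =>
    MeasurableSpace.comap (x l) inferInstance ⊔ MeasurableSpace.comap (y l) inferInstance)
    ⟨l, by omega⟩)

theorem measurable_history_secondary (x : ℕ → Ω → Vec d₀) (y : ℕ → Ω → Tuple d) {l k : ℕ}
    (hl : l ≤ k) : Measurable[history x y k] (y l) := by
  have h1 := comap_measurable (m := inferInstance) (y l)
  refine h1.mono ?_ le_rfl
  exact le_sup_right.trans (le_iSup (fun l : Fin (k + 1) =>
    MeasurableSpace.comap (x l) inferInstance ⊔ MeasurableSpace.comap (y l) inferInstance)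
    ⟨l, by omega⟩)

theorem history_mono (x : ℕ → Ω → Vec d₀) (y : ℕ → Ω → Tuple d) (k : ℕ) :
    history x y k ≤ history x y (k + 1) :=
  iSup_le fun l => sup_le
    (measurable_history_main x y (show (l : ℕ) ≤ k + 1 by omega)).comap_le
    (measurable_history_secondary x y (show (l : ℕ) ≤ k + 1 by omega)).comap_le

variable [mΩ : MeasurableSpace Ω]

variable {μ₀ m ℓ₀ L M : ℝ} {c : Constants N} {σ : ℝ}
  {P : Measure Ω} {v : Vec d₀ → Tuple d → Vec d₀} {h : SecondaryOps d₀ d} {xs : Vec d₀}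
  {K : ℕ} {α : ℕ → ℝ} {β : ℕ → Fin N → ℝ} {x : ℕ → Ω → Vec d₀} {y : ℕ → Ω → Tuple d}
  {ξ : ℕ → Ω → Vec d₀} {ψ : ℕ → Ω → Tuple d}

/-- A run of the recursion with regular operators. -/
structure RegularRun (μ₀ m ℓ₀ L M : ℝ) (c : Constants N) (σ : ℝ) (P : Measure Ω)
    (v : Vec d₀ → Tuple d → Vec d₀) (h : SecondaryOps d₀ d) (xs : Vec d₀) (K : ℕ) (α : ℕ → ℝ)
    (β : ℕ → Fin N → ℝ) (x : ℕ → Ω → Vec d₀) (y : ℕ → Ω → Tuple d) (ξ : ℕ → Ω → Vec d₀)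
    (ψ : ℕ → Ω → Tuple d) : Prop where
  ops : RegularOps μ₀ m ℓ₀ L M v h xs
  measurable_main : Measurable fun z : Vec d₀ × Tuple d => v z.1 z.2
  continuous_secondary : ∀ n,
    Continuous fun z : (Vec d₀ × Prev d n) × Vec (d n) => h n z.1.1 z.1.2 z.2
  run : IsMSSA P v h K α β x y ξ ψ
  noise : NoiseAssumption c σ P v h K x y ξ ψ

theorem IsMSSA.history_le (hr : IsMSSA P v h K α β x y ξ ψ) {k : ℕ} (hk : k ≤ K) :
    history x y k ≤ mΩ :=
  iSup_le fun l => sup_le (hr.measurable_x l (by omega)).comap_le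
    (hr.measurable_y l (by omega)).comap_le

namespace RegularRun

/-- The filter receives the same `-α ξ` as the iterate, so it cancels; the damping of the filter
survives as the correction `μ₀ (x - z)`. -/
theorem cleanMain_succ (hr : RegularRun μ₀ m ℓ₀ L M c σ P v h xs K α β x y ξ ψ) {k : ℕ}
    (hk : k < K) (w : Ω) :
    cleanMain μ₀ α x ξ (k + 1) w = cleanMain μ₀ α x ξ k w -
      α k • mainDrift μ₀ v (x k w) (y k w) (cleanMain μ₀ α x ξ k w) := by
  simp only [cleanMain, mainDrift, filteredNoise, hr.run.step_x k hk w, sub_sub_cancel]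
  module

theorem cleanSecondary_succ (hr : RegularRun μ₀ m ℓ₀ L M c σ P v h xs K α β x y ξ ψ) {k : ℕ}
    (hk : k < K) (w : Ω) (n : Fin N) :
    cleanSecondary μ₀ β y ψ (k + 1) w n = cleanSecondary μ₀ β y ψ k w n -
      β k n • secondaryDrift μ₀ h (x k w) (y k w) (cleanSecondary μ₀ β y ψ k w) n := by
  simp only [cleanSecondary, filteredNoiseTuple, secondaryDrift, filteredNoise,
    hr.run.step_y k hk w n, sub_sub_cancel]
  module

/-- The noise `α ξ^k` can be read off from `x^k`, `y^k` and `x^{k+1}` through the recursion, so the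
filter is adapted to the history of the iterates alone. -/
theorem measurable_filteredNoise (hr : RegularRun μ₀ m ℓ₀ L M c σ P v h xs K α β x y ξ ψ) :
    ∀ k ≤ K, Measurable[history x y k] (filteredNoise μ₀ α ξ k) := by
  intro k
  induction k with
  | zero => intro _; exact measurable_const
  | succ k ih =>
    intro hk
    have e : filteredNoise μ₀ α ξ (k + 1) = fun w => (1 - μ₀ * α k) • filteredNoise μ₀ α ξ k w +
        (x (k + 1) w - x k w + α k • v (x k w) (y k w)) := by
      funext w
      rw [hr.run.step_x k (by omega) w, filteredNoise]
      module
    have m1 : Measurable[history x y (k + 1)] (filteredNoise μ₀ α ξ k) :=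
      (ih (by omega)).mono (history_mono x y k) le_rfl
    have m2 := measurable_history_main x y (le_refl (k + 1))
    have m3 := measurable_history_main x y (Nat.le_succ k)
    have m4 := measurable_history_secondary x y (Nat.le_succ k)
    have m5 : Measurable[history x y (k + 1)] fun w => v (x k w) (y k w) :=
      hr.measurable_main.comp (m3.prodMk m4)
    rw [e]
    exact (m1.const_smul (1 - μ₀ * α k)).add ((m2.sub m3).add (m5.const_smul (α k)))

theorem measurable_filteredNoiseTuple
    (hr : RegularRun μ₀ m ℓ₀ L M c σ P v h xs K α β x y ξ ψ) (n : Fin N) :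
    ∀ k ≤ K, Measurable[history x y k] (fun w => filteredNoiseTuple μ₀ β ψ k w n) := by
  intro k
  induction k with
  | zero => intro _; exact measurable_const
  | succ k ih =>
    intro hk
    have e : (fun w => filteredNoiseTuple μ₀ β ψ (k + 1) w n) = fun w =>
        (1 - μ₀ * β k n) • filteredNoiseTuple μ₀ β ψ k w n +
        (y (k + 1) w n - y k w n + β k n • h n (x k w) (prev n (y k w)) (y k w n)) := by
      funext w
      rw [hr.run.step_y k (by omega) w n]
      simp only [filteredNoiseTuple, filteredNoise]
      module
    have m1 : Measurable[history x y (k + 1)] (fun w => filteredNoiseTuple μ₀ β ψ k w n) :=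
      (ih (by omega)).mono (history_mono x y k) le_rfl
    have m2 := measurable_history_secondary x y (le_refl (k + 1))
    have m3 := measurable_history_main x y (Nat.le_succ k)
    have m4 := measurable_history_secondary x y (Nat.le_succ k)
    have m6 : Measurable[history x y (k + 1)] fun w => y (k + 1) w n :=
      (measurable_pi_apply n).comp m2
    have m7 : Measurable[history x y (k + 1)] fun w => y k w n := (measurable_pi_apply n).comp m4
    have m5 : Measurable[history x y (k + 1)]
        fun w => h n (x k w) (prev n (y k w)) (y k w n) :=
      (hr.continuous_secondary n).measurable.comp
        ((m3.prodMk ((continuous_prev n).measurable.comp m4)).prodMk m7)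
    rw [e]
    exact (m1.const_smul (1 - μ₀ * β k n)).add ((m6.sub m7).add (m5.const_smul (β k n)))

theorem memLp_iterate [IsProbabilityMeasure P]
    (hr : RegularRun μ₀ m ℓ₀ L M c σ P v h xs K α β x y ξ ψ) :
    ∀ k ≤ K, MemLp (x k) 2 P ∧ ∀ n, MemLp (fun w => y k w n) 2 P := by
  intro k
  induction k with
  | zero => intro _; exact ⟨hr.run.memLp_x, hr.run.memLp_y⟩
  | succ k ih =>
    intro hk
    obtain ⟨hx, hy⟩ := ih (by omega)
    have hxm := hr.run.measurable_x k (by omega)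
    have hym := hr.run.measurable_y k (by omega)
    refine ⟨?_, fun n => ?_⟩
    · rw [show x (k + 1) = fun w => x k w - α k • (v (x k w) (y k w) + ξ k w) from
        funext (hr.run.step_x k (by omega))]
      exact hx.sub (((hr.ops.memLp_main hr.measurable_main hx hy hxm hym).add
        (hr.noise.memLp_ξ k (by omega))).const_smul (α k))
    · rw [show (fun w => y (k + 1) w n) = fun w => y k w n -
        β k n • (h n (x k w) (prev n (y k w)) (y k w n) + ψ k w n) from
        funext fun w => hr.run.step_y k (by omega) w n]
      exact (hy n).sub (((hr.ops.memLp_secondary hr.continuous_secondary hx hy hxm hym n).add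
        (hr.noise.memLp_ψ k (by omega) n)).const_smul (β k n))

theorem memLp_noise (hr : RegularRun μ₀ m ℓ₀ L M c σ P v h xs K α β x y ξ ψ)
    {k : ℕ} (hk : k ≤ K) : MemLp (filteredNoise μ₀ α ξ k) 2 P :=
  memLp_filteredNoise hr.noise.memLp_ξ k hk

theorem memLp_noiseTuple (hr : RegularRun μ₀ m ℓ₀ L M c σ P v h xs K α β x y ξ ψ)
    {k : ℕ} (hk : k ≤ K) (n : Fin N) :
    MemLp (fun w => filteredNoiseTuple μ₀ β ψ k w n) 2 P :=
  memLp_filteredNoise (ζ := fun k w => ψ k w n) (fun k hk => hr.noise.memLp_ψ k hk n) k hk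

/-- The expected Lyapunov function of the noise-free parts. -/
noncomputable def expLyapunov (μ₀ : ℝ) (P : Measure Ω) (h : SecondaryOps d₀ d) (xs : Vec d₀)
    (α : ℕ → ℝ) (β : ℕ → Fin N → ℝ) (x : ℕ → Ω → Vec d₀) (y : ℕ → Ω → Tuple d)
    (ξ : ℕ → Ω → Vec d₀) (ψ : ℕ → Ω → Tuple d) (k : ℕ) : ℝ :=
  ∫ w, lyapunov h xs (cleanMain μ₀ α x ξ k w) (cleanSecondary μ₀ β y ψ k w) ∂P

/-- The expected squared filtered noise. -/
noncomputable def expNoise (μ₀ : ℝ) (P : Measure Ω)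
    (α : ℕ → ℝ) (β : ℕ → Fin N → ℝ) (ξ : ℕ → Ω → Vec d₀) (ψ : ℕ → Ω → Tuple d) (k : ℕ) : ℝ :=
  ∫ w, ‖filteredNoise μ₀ α ξ k w‖ ^ 2 ∂P + ∑ n, ∫ w, ‖filteredNoiseTuple μ₀ β ψ k w n‖ ^ 2 ∂P

theorem expNoise_nonneg (μ₀ : ℝ) (P : Measure Ω)
    (α : ℕ → ℝ) (β : ℕ → Fin N → ℝ) (ξ : ℕ → Ω → Vec d₀) (ψ : ℕ → Ω → Tuple d) (k : ℕ) :
    0 ≤ expNoise μ₀ P α β ξ ψ k :=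
  add_nonneg (integral_nonneg fun _ => by positivity)
    (Finset.sum_nonneg fun _ _ => integral_nonneg fun _ => by positivity)

theorem expLyapunov_nonneg (k : ℕ) : 0 ≤ expLyapunov μ₀ P h xs α β x y ξ ψ k :=
  integral_nonneg fun _ => lyapunov_nonneg _ _ _ _

theorem integrable_gapSq (hr : RegularRun μ₀ m ℓ₀ L M c σ P v h xs K α β x y ξ ψ)
    {k : ℕ} (hk : k ≤ K) :
    Integrable (fun w => gapSq (x k w) (y k w) (cleanMain μ₀ α x ξ k w)
      (cleanSecondary μ₀ β y ψ k w)) P := by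
  simp_rw [gapSq_clean]
  exact ((hr.memLp_noise hk).integrable_norm_pow two_ne_zero).add
    (integrable_finsetSum _ fun n _ =>
      (hr.memLp_noiseTuple hk n).integrable_norm_pow two_ne_zero)

theorem integral_gapSq (hr : RegularRun μ₀ m ℓ₀ L M c σ P v h xs K α β x y ξ ψ)
    {k : ℕ} (hk : k ≤ K) :
    ∫ w, gapSq (x k w) (y k w) (cleanMain μ₀ α x ξ k w) (cleanSecondary μ₀ β y ψ k w) ∂P =
      expNoise μ₀ P α β ξ ψ k := by
  simp_rw [gapSq_clean]
  have i2 : ∀ n, Integrable (fun w => ‖filteredNoiseTuple μ₀ β ψ k w n‖ ^ 2) P := fun n =>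
    (hr.memLp_noiseTuple hk n).integrable_norm_pow two_ne_zero
  rw [integral_add ((hr.memLp_noise hk).integrable_norm_pow two_ne_zero)
    (integrable_finsetSum _ fun n _ => i2 n), integral_finsetSum _ fun n _ => i2 n, expNoise]

variable [IsProbabilityMeasure P]

theorem integrable_lyapunov (hr : RegularRun μ₀ m ℓ₀ L M c σ P v h xs K α β x y ξ ψ)
    {k : ℕ} (hk : k ≤ K) :
    Integrable (fun w => lyapunov h xs (cleanMain μ₀ α x ξ k w)
      (cleanSecondary μ₀ β y ψ k w)) P := by
  obtain ⟨hx, hy⟩ := hr.memLp_iterate k hk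
  have hle := hr.run.history_le hk
  refine hr.ops.integrable_lyapunov (hx.sub (hr.memLp_noise hk))
    (fun n => (hy n).sub (hr.memLp_noiseTuple hk n)) ?_ ?_
  · exact (hr.run.measurable_x k hk).sub ((hr.measurable_filteredNoise k hk).mono hle le_rfl)
  · refine measurable_pi_lambda _ fun n => ?_
    exact ((measurable_pi_apply n).comp (hr.run.measurable_y k hk)).sub
      ((hr.measurable_filteredNoiseTuple n k hk).mono hle le_rfl)

/-- The contraction holds path by path, so taking expectations requires no conditioning; the
expected squared gap is `expNoise`. -/
theorem expLyapunov_succ_le (hr : RegularRun μ₀ m ℓ₀ L M c σ P v h xs K α β x y ξ ψ)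
    {κ : ℝ} (hκ : RatioSmall N μ₀ m (growth N μ₀ ℓ₀ L M) M κ) {k : ℕ} (hk : k < K)
    (hst : StepSmall μ₀ m (growth N μ₀ ℓ₀ L M) κ (α k) (β k)) :
    expLyapunov μ₀ P h xs α β x y ξ ψ (k + 1) ≤
      (1 - α k * μ₀ / 2) * expLyapunov μ₀ P h xs α β x y ξ ψ k +
        lyapunovConst N μ₀ m (growth N μ₀ ℓ₀ L M) M * (α k + ∑ n, β k n) * (N + 1) *
          expNoise μ₀ P α β ξ ψ k := by
  have hμ := hr.ops.μ₀_pos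
  have hm := hr.ops.m_pos
  set A := lyapunovConst N μ₀ m (growth N μ₀ ℓ₀ L M) M * (α k + ∑ n, β k n) with hA
  have hA0 : 0 ≤ A := by
    refine mul_nonneg ?_ (add_nonneg hst.α_pos.le (Finset.sum_nonneg fun n _ =>
      (hst.β_pos n).le))
    unfold lyapunovConst pertConst shiftConst
    positivity
  have i0 := hr.integrable_lyapunov hk.le
  have i1 := hr.integrable_gapSq hk.le
  rw [← hr.integral_gapSq hk.le, expLyapunov, expLyapunov, ← integral_const_mul,
    ← integral_const_mul, ← integral_add (i0.const_mul _) (i1.const_mul _)]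
  refine integral_mono (hr.integrable_lyapunov hk) ((i0.const_mul _).add (i1.const_mul _))
    fun w => ?_
  have h1 := hr.ops.lyapunov_step hκ hst (x k w) _ _ (y k w) _ _ (hr.cleanMain_succ hk w)
    (hr.cleanSecondary_succ hk w)
  have h2 := mul_le_mul_of_nonneg_left (gap_sq_le (x k w) (y k w) (cleanMain μ₀ α x ξ k w)
    (cleanSecondary μ₀ β y ψ k w)) hA0
  refine h1.trans ?_
  rw [mul_assoc A]
  exact add_le_add_right h2 _

theorem integral_value_sq_le (hr : RegularRun μ₀ m ℓ₀ L M c σ P v h xs K α β x y ξ ψ)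
    {k : ℕ} (hk : k ≤ K) {f : Ω → ℝ} {A : ℝ} (hf0 : Integrable f P)
    (hf : ∀ w, f w ≤ A * (lyapunov h xs (cleanMain μ₀ α x ξ k w) (cleanSecondary μ₀ β y ψ k w) +
      gapSq (x k w) (y k w) (cleanMain μ₀ α x ξ k w) (cleanSecondary μ₀ β y ψ k w))) :
    ∫ w, f w ∂P ≤ A *
      (expLyapunov μ₀ P h xs α β x y ξ ψ k + expNoise μ₀ P α β ξ ψ k) := by
  have i0 := hr.integrable_lyapunov hk
  have i1 := hr.integrable_gapSq hk
  rw [← hr.integral_gapSq hk, expLyapunov, ← integral_add i0 i1, ← integral_const_mul]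
  exact integral_mono hf0 ((i0.add i1).const_mul A) hf

theorem integral_noise_sq_le (hr : RegularRun μ₀ m ℓ₀ L M c σ P v h xs K α β x y ξ ψ)
    {k : ℕ} (hk : k < K) :
    ∫ w, ‖ξ k w‖ ^ 2 ∂P ≤ noiseConst c μ₀ ℓ₀ L M *
      (expLyapunov μ₀ P h xs α β x y ξ ψ k + expNoise μ₀ P α β ξ ψ k) + σ ^ 2 := by
  obtain ⟨hx, hy⟩ := hr.memLp_iterate k hk.le
  have hxm := hr.run.measurable_x k hk.le
  have hym := hr.run.measurable_y k hk.le
  have iv := (hr.ops.memLp_main hr.measurable_main hx hy hxm hym).integrable_norm_pow two_ne_zero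
  have ih := fun n => (hr.ops.memLp_secondary hr.continuous_secondary hx hy hxm hym n
    ).integrable_norm_pow two_ne_zero
  have ihs : Integrable (fun w => ∑ n, ‖h n (x k w) (prev n (y k w)) (y k w n)‖ ^ 2) P :=
    integrable_finsetSum _ fun n _ => ih n
  have i1 : Integrable (fun w => c.ω₁ * ‖v (x k w) (y k w)‖ ^ 2 + σ ^ 2) P :=
    (iv.const_mul c.ω₁).add (integrable_const _)
  have h1 := integral_norm_sq_le_of_condVariance (hr.run.history_le hk.le)
    (hr.noise.condExp_ξ k hk) (i1.add (ihs.const_mul c.ω₂)) (hr.noise.condVar_ξ k hk)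
  simp only [Pi.add_apply] at h1
  rw [integral_add i1 (ihs.const_mul c.ω₂), integral_add (iv.const_mul c.ω₁)
    (integrable_const _), integral_const_mul, integral_const_mul, integral_finsetSum _
    fun n _ => ih n] at h1
  simp only [integral_const, probReal_univ, one_smul] at h1
  have h2 := hr.integral_value_sq_le hk.le iv fun w => hr.ops.norm_main_sq_le _ _ _ _
  have h3 := fun n => hr.integral_value_sq_le hk.le (ih n) fun w =>
    hr.ops.norm_secondary_sq_le _ _ _ _ n
  have h4 := Finset.sum_le_sum fun n (_ : n ∈ Finset.univ) => h3 n
  simp only [Finset.sum_const, Finset.card_univ, Fintype.card_fin, nsmul_eq_mul] at h4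
  set E := expLyapunov μ₀ P h xs α β x y ξ ψ k + expNoise μ₀ P α β ξ ψ k
  have hE : 0 ≤ E := add_nonneg (expLyapunov_nonneg k) (expNoise_nonneg _ _ _ _ _ _ k)
  have h5 := mul_le_mul_of_nonneg_left h2 c.ω₁_pos.le
  have h6 := mul_le_mul_of_nonneg_left h4 c.ω₂_pos.le
  -- The `ω₀` term is slack here: one constant is meant to serve the main and the secondary noises.
  have h7 : 0 ≤ c.ω₀ * (valueConst N μ₀ ℓ₀ L M * E) := by
    have := c.ω₀_pos
    unfold valueConst
    positivity
  unfold noiseConst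
  linarith

theorem integral_noiseTuple_sq_le (hr : RegularRun μ₀ m ℓ₀ L M c σ P v h xs K α β x y ξ ψ)
    {k : ℕ} (hk : k < K) (n : Fin N) :
    ∫ w, ‖ψ k w n‖ ^ 2 ∂P ≤ noiseConst c μ₀ ℓ₀ L M *
      (expLyapunov μ₀ P h xs α β x y ξ ψ k + expNoise μ₀ P α β ξ ψ k) + σ ^ 2 := by
  obtain ⟨hx, hy⟩ := hr.memLp_iterate k hk.le
  have hxm := hr.run.measurable_x k hk.le
  have hym := hr.run.measurable_y k hk.le
  have ih := (hr.ops.memLp_secondary hr.continuous_secondary hx hy hxm hym n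
    ).integrable_norm_pow two_ne_zero
  have h1 := integral_norm_sq_le_of_condVariance (hr.run.history_le hk.le)
    (hr.noise.condExp_ψ k hk n) ((ih.const_mul c.ω₀).add (integrable_const (σ ^ 2)))
    (hr.noise.condVar_ψ k hk n)
  simp only [Pi.add_apply] at h1
  rw [integral_add (ih.const_mul c.ω₀) (integrable_const _), integral_const_mul] at h1
  simp only [integral_const, probReal_univ, one_smul] at h1
  have h3 := hr.integral_value_sq_le hk.le ih fun w => hr.ops.norm_secondary_sq_le _ _ _ _ n
  set E := expLyapunov μ₀ P h xs α β x y ξ ψ k + expNoise μ₀ P α β ξ ψ k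
  have hE : 0 ≤ E := add_nonneg (expLyapunov_nonneg k) (expNoise_nonneg _ _ _ _ _ _ k)
  have h5 := mul_le_mul_of_nonneg_left h3 c.ω₀_pos.le
  have h7 : 0 ≤ (c.ω₁ + N * c.ω₂) * (valueConst N μ₀ ℓ₀ L M * E) := by
    have := c.ω₁_pos
    have := c.ω₂_pos
    unfold valueConst
    positivity
  unfold noiseConst
  linarith

/-- The variance bounds depend on the state, so `expLyapunov` feeds back into the noise, but only
with the factor `b²`. -/
theorem expNoise_succ_le (hr : RegularRun μ₀ m ℓ₀ L M c σ P v h xs K α β x y ξ ψ)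
    {k : ℕ} (hk : k < K) {b : ℝ} (hα : 0 < α k) (hαb : α k ≤ b) (hαβ : ∀ n, α k ≤ β k n)
    (hβb : ∀ n, β k n ≤ b) (hb : μ₀ * b ≤ 1) :
    expNoise μ₀ P α β ξ ψ (k + 1) ≤ (1 - α k * μ₀) * expNoise μ₀ P α β ξ ψ k +
      b ^ 2 * (N + 1) * (noiseConst c μ₀ ℓ₀ L M *
        (expLyapunov μ₀ P h xs α β x y ξ ψ k + expNoise μ₀ P α β ξ ψ k) + σ ^ 2) := by
  have hμ := hr.ops.μ₀_pos
  have hle := hr.run.history_le hk.le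
  set S := noiseConst c μ₀ ℓ₀ L M *
    (expLyapunov μ₀ P h xs α β x y ξ ψ k + expNoise μ₀ P α β ξ ψ k) + σ ^ 2 with hS
  have hξ : ∫ w, ‖ξ k w‖ ^ 2 ∂P ≤ S := hr.integral_noise_sq_le hk
  have hψ : ∀ n, ∫ w, ‖ψ k w n‖ ^ 2 ∂P ≤ S := fun n => hr.integral_noiseTuple_sq_le hk n
  have h1 := integral_filteredNoise_step hle (l := μ₀) (γ := α) (by positivity)
    ((mul_le_mul_of_nonneg_left hαb hμ.le).trans hb) (hr.memLp_noise hk.le)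
    (hr.noise.memLp_ξ k hk) (hr.measurable_filteredNoise k hk.le).aestronglyMeasurable
    (hr.noise.condExp_ξ k hk)
  have hm1 : α k ^ 2 * ∫ w, ‖ξ k w‖ ^ 2 ∂P ≤ b ^ 2 * S :=
    mul_le_mul (pow_le_pow_left₀ hα.le hαb 2) hξ (integral_nonneg fun _ => by positivity)
      (sq_nonneg b)
  have h2 : ∀ n, ∫ w, ‖filteredNoiseTuple μ₀ β ψ (k + 1) w n‖ ^ 2 ∂P ≤
      (1 - α k * μ₀) * ∫ w, ‖filteredNoiseTuple μ₀ β ψ k w n‖ ^ 2 ∂P + b ^ 2 * S := by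
    intro n
    have hβ0 : 0 < β k n := hα.trans_le (hαβ n)
    have h3 := integral_filteredNoise_step hle (l := μ₀) (γ := fun k => β k n)
      (ζ := fun k w => ψ k w n) (mul_nonneg hμ.le hβ0.le)
      ((mul_le_mul_of_nonneg_left (hβb n) hμ.le).trans hb) (hr.memLp_noiseTuple hk.le n)
      (hr.noise.memLp_ψ k hk n) (hr.measurable_filteredNoiseTuple n k hk.le).aestronglyMeasurable
      (hr.noise.condExp_ψ k hk n)
    refine h3.trans (add_le_add ?_ ?_)
    -- Since `α ≤ β_n`, the secondary filters contract at least as fast as the main one, and the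
    -- common rate is `α μ₀`.
    · refine mul_le_mul_of_nonneg_right ?_ (integral_nonneg fun _ => by positivity)
      have := mul_le_mul_of_nonneg_left (hαβ n) hμ.le
      linarith
    · exact mul_le_mul (pow_le_pow_left₀ hβ0.le (hβb n) 2) (hψ n)
        (integral_nonneg fun _ => by positivity) (sq_nonneg b)
  have h4 := Finset.sum_le_sum fun n (_ : n ∈ Finset.univ) => h2 n
  rw [Finset.sum_add_distrib, ← Finset.mul_sum] at h4
  simp only [Finset.sum_const, Finset.card_univ, Fintype.card_fin, nsmul_eq_mul] at h4
  unfold expNoise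
  linarith

end RegularRun

end Run

/-! ### Solving the scalar recursions. -/

section Rate

open Filter Topology

theorem le_of_affine_recursion {θ E : ℝ} {K : ℕ} {W : ℕ → ℝ} (hθ : 0 < θ) (hθ1 : θ ≤ 1)
    (hE : 0 ≤ E) (hW : ∀ k < K, W (k + 1) ≤ (1 - θ) * W k + E) :
    W K ≤ (1 - θ) ^ K * W 0 + E / θ := by
  have key : ∀ k ≤ K, W k ≤ (1 - θ) ^ k * W 0 + E / θ := by
    intro k
    induction k with
    | zero => intro _; simpa using div_nonneg hE hθ.le
    | succ k ih =>
      intro hk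
      have h1 := mul_le_mul_of_nonneg_left (ih (by omega)) (sub_nonneg.2 hθ1)
      have h2 : (1 - θ) * (E / θ) + E = E / θ := by field_simp; ring
      have h3 := hW k (by omega)
      rw [pow_succ]
      linarith
  exact key K le_rfl

/-- The combined recursion of the expected Lyapunov function and the expected squared noise. -/
theorem combined_recursion {V Q : ℕ → ℝ} {α : ℕ → ℝ} {μ₀ A F S R b τ Γ : ℝ} {K : ℕ}
    (hμ : 0 < μ₀) (hF : 0 ≤ F) (hR : 0 ≤ R) (hb : 0 ≤ b) (hτ : 0 < τ)
    (hΓ : 1 ≤ Γ) (hA : 0 ≤ A) (hAΓ : A * R ≤ Γ * (μ₀ / 4)) (hbΓ : b * (Γ * F * R) ≤ μ₀ / 4)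
    (hbτ : b ≤ R * τ) (hα : ∀ k < K, τ ≤ α k)
    (hV0 : ∀ k, 0 ≤ V k) (hQ0 : ∀ k, 0 ≤ Q k)
    (hV : ∀ k < K, V (k + 1) ≤ (1 - α k * μ₀ / 2) * V k + A * b * Q k)
    (hQ : ∀ k < K, Q (k + 1) ≤ (1 - α k * μ₀) * Q k + b ^ 2 * (F * (V k + Q k) + S)) :
    ∀ k < K, V (k + 1) + Γ * Q (k + 1) ≤
      (1 - τ * μ₀ / 4) * (V k + Γ * Q k) + Γ * b ^ 2 * S := by
  intro k hk
  have hα0 : 0 < α k := hτ.trans_le (hα k hk)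
  have hbα : b ≤ R * α k := hbτ.trans (mul_le_mul_of_nonneg_left (hα k hk) hR)
  have hΓ0 : 0 ≤ Γ := zero_le_one.trans hΓ
  have hv := hV0 k
  have hq := hQ0 k
  have h1 := hV k hk
  have h2 := mul_le_mul_of_nonneg_left (hQ k hk) hΓ0
  -- Feedback of the state-dependent noise: one factor `b` is made small and the other is comparable
  -- to `α`, so a quarter of the rate absorbs it.
  have h3 : Γ * (b ^ 2 * F) * (V k + Q k) ≤ α k * μ₀ / 4 * (V k + Q k) := by
    refine mul_le_mul_of_nonneg_right ?_ (add_nonneg hv hq)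
    calc Γ * (b ^ 2 * F) = b * (Γ * F * b) := by ring
      _ ≤ b * (Γ * F * (R * α k)) := by gcongr
      _ = b * (Γ * F * R) * α k := by ring
      _ ≤ μ₀ / 4 * α k := by gcongr
      _ = _ := by ring
  -- The noise forcing in `V` is of the same order as the decay of `Q`, not smaller; only a large
  -- weight `Γ` absorbs it.
  have h4 : A * b * Q k ≤ Γ * (α k * μ₀ / 4 * Q k) := by
    calc A * b * Q k ≤ A * (R * α k) * Q k := by gcongr
      _ = A * R * (α k * Q k) := by ring
      _ ≤ Γ * (μ₀ / 4) * (α k * Q k) := by gcongr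
      _ = _ := by ring
  have h5 : τ * μ₀ / 4 * (V k + Γ * Q k) ≤ α k * μ₀ / 4 * (V k + Γ * Q k) := by
    have := hα k hk
    gcongr
  have h6 : α k * μ₀ / 4 * Q k ≤ Γ * (α k * μ₀ / 4 * Q k) :=
    le_mul_of_one_le_left (by positivity) hΓ
  have h7 : 0 ≤ Γ * (α k * μ₀ / 4 * Q k) := by positivity
  linarith only [h1, h2, h3, h4, h5, h6, h7]

theorem eventually_mul_log_div_le (A : ℝ) {ε : ℝ} (hε : 0 < ε) :
    ∀ᶠ K : ℕ in atTop, A * (Real.log K / K) ≤ ε := by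
  have h1 : Tendsto (fun t : ℝ => Real.log t / t) atTop (𝓝 0) := by
    simpa using Real.isLittleO_log_id_atTop.tendsto_div_nhds_zero
  have h2 : Tendsto (fun K : ℕ => A * (Real.log K / K)) atTop (𝓝 (A * 0)) :=
    (h1.comp tendsto_natCast_atTop_atTop).const_mul A
  rw [mul_zero] at h2
  exact h2.eventually_le_const hε

theorem eventually_le_log (A : ℝ) : ∀ᶠ K : ℕ in atTop, A ≤ Real.log K :=
  (Real.tendsto_log_atTop.comp tendsto_natCast_atTop_atTop).eventually_ge_atTop A

/-- The solution of the combined recursion for step sizes of order `log K / K`. -/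
theorem final_bound {W : ℕ → ℝ} {a B S D θ : ℝ} {K : ℕ} (ha : 0 < a) (hS : 0 ≤ S)
    (hK : 0 < K) (hlog : 1 ≤ Real.log K) (hloga : -2 * Real.log a ≤ Real.log K)
    (hθ : θ = Real.log (a * K) / K) (hθ1 : θ ≤ 1) (hD : W 0 ≤ D) (hD0 : 0 ≤ D)
    (hW : ∀ k < K, W (k + 1) ≤ (1 - θ) * W k + (B * (Real.log K / K)) ^ 2 * S) :
    W K ≤ (D / a + 2 * B ^ 2 * S) * (Real.log K / K) := by
  have hK' : (0 : ℝ) < K := by exact_mod_cast hK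
  have hlogm : Real.log (a * K) = Real.log a + Real.log K :=
    Real.log_mul ha.ne' hK'.ne'
  have hhalf : Real.log K / 2 ≤ Real.log (a * K) := by rw [hlogm]; linarith
  have hla : 0 < Real.log (a * K) := by linarith
  have hθ0 : 0 < θ := by rw [hθ]; positivity
  have h1 := le_of_affine_recursion hθ0 hθ1 (by positivity) hW
  -- This is where the logarithm in the step size is spent: `exp (-Kθ) = 1/(aK)`.
  have h2 : (1 - θ) ^ K ≤ 1 / (a * K) := by
    calc (1 - θ) ^ K ≤ Real.exp (-θ) ^ K :=
          pow_le_pow_left₀ (sub_nonneg.2 hθ1) (Real.one_sub_le_exp_neg θ) K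
      _ = Real.exp (-Real.log (a * K)) := by
          rw [← Real.exp_nat_mul, hθ]; congr 1; field_simp
      _ = _ := by rw [Real.exp_neg, Real.exp_log (by positivity), one_div]
  have h3 : (1 - θ) ^ K * W 0 ≤ D / a * (Real.log K / K) := by
    calc (1 - θ) ^ K * W 0 ≤ (1 - θ) ^ K * D :=
          mul_le_mul_of_nonneg_left hD (pow_nonneg (sub_nonneg.2 hθ1) K)
      _ ≤ 1 / (a * K) * D := mul_le_mul_of_nonneg_right h2 hD0
      _ = D / a * (1 / K) := by field_simp
      _ ≤ _ := by gcongr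
  have h4 : (B * (Real.log K / K)) ^ 2 * S / θ ≤ 2 * B ^ 2 * S * (Real.log K / K) := by
    rw [div_le_iff₀ hθ0]
    have h5 : Real.log K / K ≤ 2 * θ := by
      rw [hθ, ← mul_div_assoc]
      gcongr
      linarith
    calc (B * (Real.log K / K)) ^ 2 * S = B ^ 2 * S * (Real.log K / K) * (Real.log K / K) := by
          ring
      _ ≤ B ^ 2 * S * (Real.log K / K) * (2 * θ) := by gcongr
      _ = _ := by ring
  linarith

end Rate

/-! ### Constants uniform in the level. -/

section Uniform

variable {N : ℕ}

/-- A uniform modulus of strong monotonicity of the secondary operators. -/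
noncomputable def Constants.modulus (c : Constants N) : ℝ := (1 + ∑ n, (c.μ n)⁻¹)⁻¹

/-- A uniform Lipschitz constant of `h_n` in its last variable. -/
noncomputable def Constants.lastLip (c : Constants N) : ℝ := 1 + ∑ n, (c.ℓ n + c.ℓA' n)

/-- A uniform Lipschitz constant of the fixed-point maps. -/
noncomputable def Constants.starLip (c : Constants N) : ℝ := 1 + ∑ n, c.fixLip n

theorem Constants.modulus_pos (c : Constants N) : 0 < c.modulus := by
  have : 0 ≤ ∑ n, (c.μ n)⁻¹ := Finset.sum_nonneg fun n _ => (inv_pos.2 (c.μ_pos n)).le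
  unfold Constants.modulus
  positivity

theorem Constants.modulus_le (c : Constants N) (n : Fin N) : c.modulus ≤ c.μ n := by
  have h0 := Finset.single_le_sum (f := fun n => (c.μ n)⁻¹)
    (fun n _ => (inv_pos.2 (c.μ_pos n)).le) (Finset.mem_univ n)
  exact inv_le_of_inv_le₀ (c.μ_pos n) (by linarith)

theorem le_one_add_sum {f : Fin N → ℝ} (hf : ∀ n, 0 < f n) (n : Fin N) : f n ≤ 1 + ∑ n, f n := by
  have := Finset.single_le_sum (f := f) (fun n _ => (hf n).le) (Finset.mem_univ n)
  linarith

theorem one_add_sum_pos {f : Fin N → ℝ} (hf : ∀ n, 0 < f n) : 0 < 1 + ∑ n, f n := by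
  have := Finset.sum_nonneg (f := f) (s := Finset.univ) fun n _ => (hf n).le
  linarith

theorem regularOps_of_assumptions {d₀ : ℕ} {d : Fin N → ℕ} {c : Constants N}
    {v : Vec d₀ → Tuple d → Vec d₀} {h : SecondaryOps d₀ d} {xs : Vec d₀}
    (hm : SecondaryStronglyMonotone c h) (hh : SecondaryLipschitz c h)
    (hl : MainLipschitz c v h) (hs : MainStronglyMonotone c v h xs) :
    RegularOps c.μ₀ c.modulus c.ℓ₀ c.lastLip c.starLip v h xs where
  μ₀_pos := c.μ₀_pos
  m_pos := c.modulus_pos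
  ℓ₀_pos := c.ℓ₀_pos
  L_pos := one_add_sum_pos fun n => add_pos (c.ℓ_pos n) (c.ℓA'_pos n)
  M_pos := one_add_sum_pos c.fixLip_pos
  zero := yStar_spec hm hh
  mono n x p y y' := (mul_le_mul_of_nonneg_right (c.modulus_le n) (sq_nonneg _)).trans
    (hm n x p y y')
  lip n x p y y' := (hh.norm_sub_last_le n x p y y').trans
    (mul_le_mul_of_nonneg_right
      (le_one_add_sum (fun n => add_pos (c.ℓ_pos n) (c.ℓA'_pos n)) n) (norm_nonneg _))
  star n x x' p p' := (norm_yStar_sub_le hm hh n x x' p p').trans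
    (mul_le_mul_of_nonneg_right (le_one_add_sum c.fixLip_pos n) (by positivity))
  main_lip := hl
  main_zero := hs.1
  main_mono := hs.2

end Uniform

/-! ### Initial values and return to the original iterates. -/

section Conclusion

variable {Ω : Type*} [mΩ : MeasurableSpace Ω] {N d₀ : ℕ} {d : Fin N → ℕ} {μ₀ m ℓ₀ L M : ℝ}
  {c : Constants N} {σ : ℝ} {P : Measure Ω}
  {v : Vec d₀ → Tuple d → Vec d₀} {h : SecondaryOps d₀ d} {xs : Vec d₀}
  {K : ℕ} {α : ℕ → ℝ} {β : ℕ → Fin N → ℝ} {x : ℕ → Ω → Vec d₀} {y : ℕ → Ω → Tuple d}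
  {ξ : ℕ → Ω → Vec d₀} {ψ : ℕ → Ω → Tuple d}

namespace RegularRun

theorem expNoise_zero : expNoise μ₀ P α β ξ ψ 0 = 0 := by
  simp [expNoise, filteredNoiseTuple, filteredNoise]

variable [IsProbabilityMeasure P]

theorem expLyapunov_zero (hr : RegularRun μ₀ m ℓ₀ L M c σ P v h xs K α β x y ξ ψ) :
    expLyapunov μ₀ P h xs α β x y ξ ψ 0 = (∫ w, ‖x 0 w - xs‖ ^ 2 ∂P) +
      ∑ n, ∫ w, ‖y 0 w n - yStar h n (x 0 w) (prev n (y 0 w))‖ ^ 2 ∂P := by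
  have i2 : ∀ n, Integrable (fun w => ‖residual h (x 0 w) (y 0 w) n‖ ^ 2) P := fun n =>
    (hr.ops.memLp_residual hr.run.memLp_x hr.run.memLp_y (hr.run.measurable_x 0 (by omega))
      (hr.run.measurable_y 0 (by omega)) n).integrable_norm_pow two_ne_zero
  have i1 : Integrable (fun w => ‖x 0 w - xs‖ ^ 2) P :=
    (hr.run.memLp_x.sub (memLp_const xs)).integrable_norm_pow two_ne_zero
  have e : ∀ w, lyapunov h xs (cleanMain μ₀ α x ξ 0 w) (cleanSecondary μ₀ β y ψ 0 w) =
      ‖x 0 w - xs‖ ^ 2 + ∑ n, ‖residual h (x 0 w) (y 0 w) n‖ ^ 2 := by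
    intro w
    have e1 : cleanMain μ₀ α x ξ 0 w = x 0 w := by simp [cleanMain, filteredNoise]
    have e2 : cleanSecondary μ₀ β y ψ 0 w = y 0 w := by
      funext n; simp [cleanSecondary, filteredNoiseTuple, filteredNoise]
    rw [e1, e2, lyapunov]
  unfold expLyapunov
  simp_rw [e]
  rw [integral_add i1 (integrable_finsetSum _ fun n _ => i2 n),
    integral_finsetSum _ fun n _ => i2 n]
  rfl

/-- The pointwise bounds hold for every `(z, q)`; at the clean sequences the squared gap integrates
to `expNoise`. The factor `N + 1` counts `f` and the `g n`. -/
theorem integral_le_of_error_bound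
    (hr : RegularRun μ₀ m ℓ₀ L M c σ P v h xs K α β x y ξ ψ) {f : Ω → ℝ}
    {g : Fin N → Ω → ℝ} (hf : Integrable f P) (hg : ∀ n, Integrable (g n) P)
    (hf' : ∀ w z q, f w ≤ errorConst N M * (lyapunov h xs z q + gapSq (x K w) (y K w) z q))
    (hg' : ∀ n w z q,
      g n w ≤ errorConst N M * (lyapunov h xs z q + gapSq (x K w) (y K w) z q)) :
    (∫ w, f w ∂P) + ∑ n, ∫ w, g n w ∂P ≤ (N + 1) * errorConst N M *
      (expLyapunov μ₀ P h xs α β x y ξ ψ K + expNoise μ₀ P α β ξ ψ K) := by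
  have h1 := hr.integral_value_sq_le le_rfl hf fun w => hf' w _ _
  have h2 := Finset.sum_le_sum fun n (_ : n ∈ Finset.univ) =>
    hr.integral_value_sq_le le_rfl (hg n) fun w => hg' n w _ _
  simp only [Finset.sum_const, Finset.card_univ, Fintype.card_fin, nsmul_eq_mul] at h2
  linarith

end RegularRun

end Conclusion

end MSSA

/-! ### Choice of constants and assembly. -/

theorem theorem1 {N : ℕ} (c : MSSA.Constants N) :
    ∃ κ : ℝ, 0 < κ ∧ κ ≤ 1 ∧
      ∀ σ a B D : ℝ, 0 < σ → 0 < a →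
      ∃ (C : ℝ) (K₀ : ℕ), ∀ K : ℕ, K₀ ≤ K →
      ∀ (d₀ : ℕ) (d : Fin N → ℕ)
        (v : MSSA.Vec d₀ → MSSA.Tuple d → MSSA.Vec d₀) (h : MSSA.SecondaryOps d₀ d)
        (xs : MSSA.Vec d₀),
      Measurable (fun z : MSSA.Vec d₀ × MSSA.Tuple d => v z.1 z.2) →
      MSSA.SecondaryStronglyMonotone c h →
      MSSA.SecondaryLipschitz c h →
      MSSA.MainLipschitz c v h →
      MSSA.MainStronglyMonotone c v h xs →
      ∀ (α : ℕ → ℝ) (β : ℕ → Fin N → ℝ), MSSA.StepSizes c κ a B K α β →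
      ∀ (Ω : Type*) [MeasurableSpace Ω] (P : MeasureTheory.Measure Ω)
        [MeasureTheory.IsProbabilityMeasure P]
        (x : ℕ → Ω → MSSA.Vec d₀) (y : ℕ → Ω → MSSA.Tuple d)
        (ξ : ℕ → Ω → MSSA.Vec d₀) (ψ : ℕ → Ω → MSSA.Tuple d),
      MSSA.IsMSSA P v h K α β x y ξ ψ →
      MSSA.NoiseAssumption c σ P v h K x y ξ ψ →
      (∫ w, ‖x 0 w - xs‖ ^ 2 ∂P) +
        ∑ n, ∫ w, ‖y 0 w n - MSSA.yStar h n (x 0 w) (MSSA.prev n (y 0 w))‖ ^ 2 ∂P ≤ D →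
      (MeasureTheory.Integrable (fun w => ‖x K w - xs‖ ^ 2) P ∧
        (∀ n, MeasureTheory.Integrable
          (fun w => ‖y K w n - MSSA.yStar h n (x K w) (MSSA.prev n (y K w))‖ ^ 2) P) ∧
        (∀ n, MeasureTheory.Integrable (fun w => ‖y K w n - MSSA.yDiamond h xs n‖ ^ 2) P)) ∧
      (∫ w, ‖x K w - xs‖ ^ 2 ∂P) +
        ∑ n, ∫ w, ‖y K w n - MSSA.yStar h n (x K w) (MSSA.prev n (y K w))‖ ^ 2 ∂P
          ≤ C * (Real.log K / K) ∧
      (∫ w, ‖x K w - xs‖ ^ 2 ∂P) + ∑ n, ∫ w, ‖y K w n - MSSA.yDiamond h xs n‖ ^ 2 ∂P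
          ≤ C * (Real.log K / K) := by
  set μ₀ := c.μ₀
  set m := c.modulus
  set ℓ₀ := c.ℓ₀
  set L := c.lastLip
  set M := c.starLip
  have hμ : 0 < μ₀ := c.μ₀_pos
  have hm : 0 < m := c.modulus_pos
  set G := MSSA.growth N μ₀ ℓ₀ L M
  obtain ⟨κ, hκ⟩ := MSSA.exists_ratioSmall N G M hμ hm
  refine ⟨κ, hκ.pos, hκ.le_one, fun σ a B D _ ha => ?_⟩
  set B₁ := max B 1
  have hB₁ : 0 < B₁ := lt_max_of_lt_right one_pos
  -- Ratio of the largest to the smallest admissible step: the lower bound on `α` is at least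
  -- `(2/μ₀) log K / K` once `log K ≥ -2 log a`.
  set R := B₁ * μ₀ / 2 with hR
  have hR0 : 0 ≤ R := by positivity
  -- One factor `N + 1` comes from squaring the gap, the other from `α + ∑ β_n ≤ (N + 1) b`.
  set A := MSSA.lyapunovConst N μ₀ m G M * (N + 1) * (N + 1) with hA
  have hlc : 0 ≤ MSSA.lyapunovConst N μ₀ m G M := by
    unfold MSSA.lyapunovConst MSSA.pertConst MSSA.shiftConst
    positivity
  have hA0 : 0 ≤ A := by positivity
  set Γ := 1 + 4 * A * R / μ₀ with hΓ
  have hΓ1 : 1 ≤ Γ := le_add_of_nonneg_right (by positivity)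
  have hAΓ : A * R ≤ Γ * (μ₀ / 4) := by
    have e : Γ * (μ₀ / 4) = μ₀ / 4 + A * R := by rw [hΓ]; field_simp
    rw [e]; linarith
  set F := (N + 1) * MSSA.noiseConst c μ₀ ℓ₀ L M with hF
  have hF0 : 0 ≤ F := by
    have := c.ω₀_pos
    have := c.ω₁_pos
    have := c.ω₂_pos
    unfold F MSSA.noiseConst MSSA.valueConst
    positivity
  set S := (N + 1) * σ ^ 2 with hS
  have hE0 : 0 ≤ (N + 1) * MSSA.errorConst N M := by
    unfold MSSA.errorConst
    positivity
  -- The threshold depends only on the constants, `a`, `B` and `N`: four requirements make the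
  -- individual steps admissible, the fifth makes the noise feedback small, and the rest concern
  -- `log K` and `K > 0`.
  have hev := (MSSA.eventually_mul_log_div_le (4 * G ^ 2 * B₁) hμ).and <|
    (MSSA.eventually_mul_log_div_le (4 * G ^ 2 * B₁) hm).and <|
    (MSSA.eventually_mul_log_div_le (m * B₁) one_pos).and <|
    (MSSA.eventually_mul_log_div_le (μ₀ * B₁) one_pos).and <|
    (MSSA.eventually_mul_log_div_le (Γ * F * R * B₁) (show 0 < μ₀ / 4 by positivity)).and <|
    (MSSA.eventually_le_log 1).and <| (MSSA.eventually_le_log (-2 * Real.log a)).and <|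
    Filter.eventually_gt_atTop 0
  obtain ⟨K₀, hK₀⟩ := Filter.eventually_atTop.1 hev
  refine ⟨(N + 1) * MSSA.errorConst N M * (|D| / a + 2 * B₁ ^ 2 * (Γ * S)), K₀, ?_⟩
  intro K hKK d₀ d v h xs hv hmono hlip hmain hsol α β hstep Ω _ P _ x y ξ ψ hrun hnoise hD
  obtain ⟨e1, e2, e3, e4, e5, hlog, hloga, hK⟩ := hK₀ K hKK
  have hK' : (0 : ℝ) < K := by exact_mod_cast hK
  set lk := Real.log K / K with hlk
  have hlk0 : 0 ≤ lk := by positivity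
  set b := B₁ * lk with hb
  have hb0 : 0 ≤ b := by positivity
  have hBb : B * lk ≤ b := mul_le_mul_of_nonneg_right (le_max_left B 1) hlk0
  have hr : MSSA.RegularRun μ₀ m ℓ₀ L M c σ P v h xs K α β x y ξ ψ :=
    ⟨MSSA.regularOps_of_assumptions hmono hlip hmain hsol, hv, MSSA.continuous_secondary hlip,
      hrun, hnoise⟩
  have hαb : ∀ k < K, α k ≤ b := fun k hk => (hstep.α_upper k hk).trans hBb
  have hβb : ∀ k < K, ∀ n, β k n ≤ b := fun k hk n => (hstep.β_upper k hk n).trans hBb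
  have hαβ : ∀ k < K, ∀ n, α k ≤ β k n := fun k hk n => (hstep.α_le_β k hk n).trans
    (mul_le_of_le_one_left (hstep.β_pos k hk n).le hκ.le_one)
  have hG2 : 0 ≤ 4 * G ^ 2 := by positivity
  have hst : ∀ k < K, MSSA.StepSmall μ₀ m G κ (α k) (β k) := fun k hk =>
    { α_pos := hstep.α_pos k hk
      β_pos := hstep.β_pos k hk
      α_small := (mul_le_mul_of_nonneg_left (hαb k hk) hG2).trans (by rw [hb]; linarith)
      β_small := fun n =>
        (mul_le_mul_of_nonneg_left (hβb k hk n) hG2).trans (by rw [hb]; linarith)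
      β_le := fun n => (mul_le_mul_of_nonneg_right (hβb k hk n) hm.le).trans
        (by rw [hb]; linarith)
      α_le_β := hstep.α_le_β k hk
      β_le_β := hstep.β_le_β k hk }
  set V := MSSA.RegularRun.expLyapunov μ₀ P h xs α β x y ξ ψ
  set Q := MSSA.RegularRun.expNoise μ₀ P α β ξ ψ
  have hV0 : ∀ k, 0 ≤ V k := MSSA.RegularRun.expLyapunov_nonneg
  have hQ0 : ∀ k, 0 ≤ Q k := MSSA.RegularRun.expNoise_nonneg μ₀ P α β ξ ψ
  have hV : ∀ k < K, V (k + 1) ≤ (1 - α k * μ₀ / 2) * V k + A * b * Q k := by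
    intro k hk
    refine (hr.expLyapunov_succ_le hκ hk (hst k hk)).trans (add_le_add_right ?_ _)
    refine mul_le_mul_of_nonneg_right ?_ (hQ0 k)
    have h1 : ∑ n, β k n ≤ N * b := by
      simpa using Finset.sum_le_sum fun n (_ : n ∈ Finset.univ) => hβb k hk n
    calc _ ≤ MSSA.lyapunovConst N μ₀ m G M * (b + N * b) * (N + 1) := by
          gcongr
          exact hαb k hk
      _ = A * b := by rw [hA]; ring
  have hQ : ∀ k < K, Q (k + 1) ≤ (1 - α k * μ₀) * Q k + b ^ 2 * (F * (V k + Q k) + S) := by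
    intro k hk
    refine (hr.expNoise_succ_le hk (hstep.α_pos k hk) (hαb k hk) (hαβ k hk) (hβb k hk)
      (by rw [hb]; linarith)).trans (le_of_eq ?_)
    rw [hF, hS]
    ring
  -- The combined contraction rate is `τ μ₀ / 4`, so the factor `4 / μ₀` makes it exactly
  -- `log(aK)/K`.
  set τ := 4 / μ₀ * (Real.log (a * K) / K) with hτ
  have hlogm : Real.log (a * K) = Real.log a + Real.log K := Real.log_mul ha.ne' hK'.ne'
  have hhalf : Real.log K / 2 ≤ Real.log (a * K) := by rw [hlogm]; linarith
  have hla : 0 < Real.log (a * K) := by linarith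
  have hτ0 : 0 < τ := by positivity
  have hbτ : b ≤ R * τ := by
    have e : R * τ = B₁ * (2 * Real.log (a * K) / K) := by
      rw [hR, hτ]; field_simp; ring
    rw [e, hb, hlk]
    gcongr
    linarith
  have hW := MSSA.combined_recursion hμ hF0 hR0 hb0 hτ0 hΓ1 hA0 hAΓ (by rw [hb]; linarith)
    hbτ hstep.α_lower hV0 hQ0 hV hQ
  have hθ1 : τ * μ₀ / 4 ≤ 1 := by
    have h1 := (hstep.α_lower 0 hK).trans (hαb 0 hK)
    have h2 : τ * μ₀ ≤ b * μ₀ := mul_le_mul_of_nonneg_right h1 hμ.le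
    rw [hb] at h2
    linarith
  have hS0 : 0 ≤ S := by positivity
  have hfin := MSSA.final_bound (W := fun k => V k + Γ * Q k) (B := B₁) (S := Γ * S) (D := |D|)
    (θ := τ * μ₀ / 4) ha (by positivity) hK hlog hloga (by rw [hτ]; field_simp) hθ1
    (by
      have h1 : V 0 ≤ D := by rw [← hr.expLyapunov_zero] at hD; exact hD
      have h2 : Q 0 = 0 := MSSA.RegularRun.expNoise_zero
      simp only [h2, mul_zero, add_zero]
      exact h1.trans (le_abs_self D))
    (abs_nonneg D)
    (fun k hk => (hW k hk).trans (le_of_eq (by rw [hb]; ring)))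
  have hVQ : (N + 1) * MSSA.errorConst N M * (V K + Q K) ≤
      (N + 1) * MSSA.errorConst N M * (|D| / a + 2 * B₁ ^ 2 * (Γ * S)) * lk := by
    rw [mul_assoc _ _ lk]
    refine mul_le_mul_of_nonneg_left (le_trans ?_ hfin) hE0
    exact add_le_add_right (le_mul_of_one_le_left (hQ0 K) hΓ1) _
  obtain ⟨hxL, hyL⟩ := hr.memLp_iterate K le_rfl
  have hxm := hrun.measurable_x K le_rfl
  have hym := hrun.measurable_y K le_rfl
  have i1 : Integrable (fun w => ‖x K w - xs‖ ^ 2) P :=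
    (hxL.sub (memLp_const xs)).integrable_norm_pow two_ne_zero
  have i2 : ∀ n, Integrable
      (fun w => ‖y K w n - MSSA.yStar h n (x K w) (MSSA.prev n (y K w))‖ ^ 2) P := fun n =>
    (hr.ops.memLp_residual hxL hyL hxm hym n).integrable_norm_pow two_ne_zero
  have i3 : ∀ n, Integrable (fun w => ‖y K w n - MSSA.yDiamond h xs n‖ ^ 2) P := fun n =>
    ((hyL n).sub (memLp_const _)).integrable_norm_pow two_ne_zero
  refine ⟨⟨i1, i2, i3⟩, le_trans ?_ hVQ, le_trans ?_ hVQ⟩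
  · exact hr.integral_le_of_error_bound i1 i2
      (fun w z q => hr.ops.norm_sub_sol_sq_le (x K w) z (y K w) q)
      (fun n w z q => hr.ops.norm_residual_sq_le (x K w) z (y K w) q n)
  · exact hr.integral_le_of_error_bound i1 i3
      (fun w z q => hr.ops.norm_sub_sol_sq_le (x K w) z (y K w) q)
      (fun n w z q => hr.ops.norm_sub_yDiamond_sol_sq_le (x K w) z (y K w) q n)
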